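/- **Setting.** Let $N,p,n\ge 1$ be integers with $p\mid N$ and $pn\ge N$, write $K=pn$, and let $M=-N/p$, so $pM=-N$. Let $b_{m,x},c_{m,x},d_{m,x}>0$ ($0\le m\le N$, $x\in\mathbb Z$) be weights that are $p$-periodic in $x$. *Tilings.* Name a unit square by the integer point it covers. For $m,x\in\mathbb Z$ the *colored* square $(m,x)$ is the one at $(m-x+N-1,\,m+x)$. A domino consists of two adjacent squares, exactly one of them colored; it is called North, West, South or East if its colored square is its right, bottom, left or top square, respectively. A domino with colored square $(m,x)$ has weight $1,\,b_{m,x},\,c_{m,x},\,d_{m,x}$ if it is North, West, South, East, respectively, and the weight $w(\mathcal T)$ of a tiling is the product of the weights of its dominoes. The $N\times N$ Aztec diamond $A_N$ is the set of the squares $(X,Y)$ with $N-1\le X+Y\le 3N-1$ and $|X-Y|\le N$; its colored squares are those with $0\le m\le N$, $0\le x\le N-1$. The weighted tiling measure is $$\mathbb P[\mathcal T]=\frac{w(\mathcal T)}{\sum_{\tilde{\mathcal T}}w(\tilde{\mathcal T})}\qquad(5.1)$$ for tilings $\mathcal T$ of $A_N$. The *extended domain* $E$ is the disjoint union of $A_N$,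 the corridor $\{(X,Y): N-1\le X+Y\le 3N-2,\ N+1\le X-Y\le 2K-N\}$, and the translate $A_{N-1}+(K+1,1-K)$ of the Aztec diamond of size $N-1$. *Paths.* For $1\le i\le 2N$ define $T_i:\mathbb Z\times\mathbb Z\to\mathbb R$ by $$T_{2m+1}(x,x)=b_{m,x-K+N},\quad T_{2m+1}(x,x-1)=c_{m,x-K+N},\quad T_{2m}(x,x)=1,\quad T_{2m}(x,y)=\prod_{k=y+1}^{x}d_{m,k-K+N}\ (y<x),$$ and zero otherwise. Let $\mu$ be the measure on integer points $(u_i^j)_{0\le i\le 2N,\,1\le j\le K}$ given by $$\frac1Z\prod_{i=1}^{2N}\det\bigl(T_i(u_{i-1}^j,u_i^k)\bigr)_{j,k=1}^{K},\qquad u_0^j=j-1,\quad u_{2N}^j=pM+j-1,$$ where $Z$ is the sum of the products of determinants over all such points. Let $\Omega_{\rm n.i.}$ be the set of collections of $K$ vertex-disjoint paths from $(0,j-1)$ to $(2N,-N+j-1)$, $j=1,\dots,K$, on the directed graph with vertices $\{0,\dots,2N\}\times\mathbb Z$ and edges $(2m,y)\to(2m+1,y)$, $(2m,y)\to(2m+1,y-1)$,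 $(2m+1,y)\to(2m+1,y-1)$, $(2m+1,y)\to(2m+2,y)$, $0\le m<N$; here $u_i^j$ is the height at which the $j$-th path first reaches level $i$. **Proposition 5.1.** 1. The matrices $T_i$ are $p\times p$ block Toeplitz, that is, $T_i(x+p,y+p)=T_i(x,y)$. The products of determinants above are non-negative, and $\mu$ is a probability measure, concentrated on the points that come from an element of $\Omega_{\rm n.i.}$, up to permuting the labels $j$ within each level $i$; so $\mu$ defines a probability measure on $\Omega_{\rm n.i.}$. 2. The following rule is a bijection from the tilings of $E$ onto $\Omega_{\rm n.i.}$. With $y=x+K-N$, a West domino with colored square $(m,x)$ gives the edge $(2m,y)\to(2m+1,y)$, a South domino the edge $(2m,y)\to(2m+1,y-1)$, an East domino the edge $(2m-1,y)\to(2m-1,y-1)$, and a North domino nothing; the paths consist of these edges and of edges $(2m+1,y)\to(2m+2,y)$. 3. In each tiling of $E$, each domino lies in one of the three parts of $E$, and those in the corridor are South dominoes. In particular each tiling of $E$ contains a tiling of $A_N$. 4. Via the bijection in 2 and restriction to $A_N$, the measure $\mu$ induces a measure on the domino tilings of $A_N$. This measure is equal to the weighted tiling measure (5.1). -/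

import Mathlib

open MeasureTheory

namespace AztecPaths

noncomputable section

/-! ## Measures with prescribed relative weights -/

/-- The measure on a discrete space that gives each point `a` mass `w a / ∑ w`. It is used for
non-negative `w`. -/
def normalizedMeasure {α : Type*} [MeasurableSpace α] (w : α → ℝ) : Measure α :=
  Measure.sum fun a => ENNReal.ofReal (w a / ∑' a', w a') • Measure.dirac a

/-! ## Dominoes and domino tilings

A unit square is named by the integer point that it covers. The colored squares are those that
cover a point `(m - x + N - 1, m + x)` with `m x : ℤ`, that is, a point whose coordinates have a
sum congruent to `N - 1` modulo `2`. -/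

/-- The four types of dominoes. -/
inductive TileKind : Type
  | north
  | west
  | south
  | east

/-- A domino, given by its type and by the coordinates `(m, x)` of its colored square. Each
`2 × 1` or `1 × 2` rectangle contains exactly one colored square, so it is exactly one of these. -/
abbrev Tile : Type := TileKind × ℤ × ℤ

/-- The colored square with coordinates `(m, x)`. -/
def blackSquare (N : ℕ) (m x : ℤ) : ℤ × ℤ := (m - x + N - 1, m + x)

/-- The position of the uncolored square of a domino relative to its colored square: the colored
square is on the right of a North domino, at the bottom of a West domino, on the left of a South
domino and at the top of an East domino. -/
def TileKind.offset : TileKind → ℤ × ℤ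
  | .north => (-1, 0)
  | .west => (0, 1)
  | .south => (1, 0)
  | .east => (0, -1)

/-- The two unit squares that a domino covers. -/
def Tile.cells (N : ℕ) (t : Tile) : Set (ℤ × ℤ) :=
  {blackSquare N t.2.1 t.2.2, blackSquare N t.2.1 t.2.2 + t.1.offset}

/-- A domino tiling of a set `R` of unit squares: a finite set of dominoes inside `R` such that
each square of `R` is covered by exactly one of them. -/
@[ext]
structure DominoTiling (N : ℕ) (R : Set (ℤ × ℤ)) where
  tiles : Finset Tile
  inside : ∀ t ∈ tiles, Tile.cells N t ⊆ R
  covers : ∀ s ∈ R, ∃! t : Tile, t ∈ tiles ∧ s ∈ Tile.cells N t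

/-- The set of tilings is discrete. -/
instance (N : ℕ) (R : Set (ℤ × ℤ)) : MeasurableSpace (DominoTiling N R) := ⊤

/-- The weight of a domino whose colored square has coordinates `(m, x)`. -/
def tileWeight (b c d : ℤ → ℤ → ℝ) : Tile → ℝ
  | (.north, _, _) => 1
  | (.west, m, x) => b m x
  | (.south, m, x) => c m x
  | (.east, m, x) => d m x

/-- The weight of a tiling: the product of the weights of its dominoes. -/
def tilingWeight (b c d : ℤ → ℤ → ℝ) {N : ℕ} {R : Set (ℤ × ℤ)} (S : DominoTiling N R) : ℝ :=
  ∏ t ∈ S.tiles, tileWeight b c d t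

/-! ## The Aztec diamond and the extended domain -/

/-- The Aztec diamond of size `N`, with `2 N (N + 1)` unit squares. Its colored squares are those
with coordinates `(m, x)`, `0 ≤ m ≤ N`, `0 ≤ x ≤ N - 1`. -/
def aztecDiamond (N : ℤ) : Set (ℤ × ℤ) :=
  {s | N - 1 ≤ s.1 + s.2 ∧ s.1 + s.2 ≤ 3 * N - 1 ∧ |s.1 - s.2| ≤ N}

/-- The diagonal corridor below the Aztec diamond of size `N`. Its colored squares are those with
coordinates `(m, x)`, `0 ≤ m ≤ N - 1`, `N - K ≤ x ≤ -1`. -/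
def corridor (N K : ℤ) : Set (ℤ × ℤ) :=
  {s | N - 1 ≤ s.1 + s.2 ∧ s.1 + s.2 ≤ 3 * N - 2 ∧ N + 1 ≤ s.1 - s.2 ∧ s.1 - s.2 ≤ 2 * K - N}

/-- The translated Aztec diamond of size `N - 1` at the lower end of the corridor. -/
def lowerDiamond (N K : ℤ) : Set (ℤ × ℤ) :=
  {s | (s.1 - (K + 1), s.2 - (1 - K)) ∈ aztecDiamond (N - 1)}

/-- The extended domain: the Aztec diamond of size `N`, the corridor, and the Aztec diamond of size
`N - 1`. Here `K` is the number of paths. -/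
def extendedDomain (N K : ℤ) : Set (ℤ × ℤ) :=
  aztecDiamond N ∪ corridor N K ∪ lowerDiamond N K

/-! ## Products of determinants -/

/-- The positions `u i j` of the `j`-th point at level `i`, where `i = 0, …, L`, and where the `K`
points of a level are numbered from `0`. -/
abbrev Config (L K : ℕ) : Type := Fin (L + 1) → Fin K → ℤ

/-- The endpoints are consecutive, starting from `0` at level `0` and from `s` at level `L`. -/
def HasEndpoints {L K : ℕ} (s : ℤ) (u : Config L K) : Prop :=
  (∀ j : Fin K, u 0 j = (j : ℤ)) ∧ ∀ j : Fin K, u (Fin.last L) j = s + (j : ℤ)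

open Classical in
/-- The product of the determinants `det (T_i (u_{i-1}^j, u_i^k))` over `i = 1, …, L`, for points
with the given endpoints. -/
def detWeight (L K : ℕ) (s : ℤ) (T : ℕ → ℤ → ℤ → ℝ) (u : Config L K) : ℝ :=
  if HasEndpoints s u then
    ∏ i : Fin L, (Matrix.of fun j k : Fin K => T (i + 1) (u i.castSucc j) (u i.succ k)).det
  else 0

/-- The measure on the points `u_i^j` given by the normalized product of determinants. -/
def detMeasure (L K : ℕ) (s : ℤ) (T : ℕ → ℤ → ℤ → ℝ) : Measure (Config L K) :=
  normalizedMeasure (detWeight L K s T)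

/-- The transition matrices `T_1, …, T_{2N}` for `K` paths. At an odd index `i = 2 m + 1` a path
stays (weight `b`) or goes down by one (weight `c`); at an even index `i = 2 m` it goes down by any
amount, with a weight `d` for each unit. -/
def transition (N K : ℕ) (b c d : ℤ → ℤ → ℝ) (i : ℕ) (x y : ℤ) : ℝ :=
  if Odd i then
    if y = x then b (i / 2 : ℕ) (x - K + N)
    else if y = x - 1 then c (i / 2 : ℕ) (x - K + N)
    else 0
  else
    if y ≤ x then ∏ k ∈ Finset.Icc (y + 1) x, d (i / 2 : ℕ) (k - K + N) else 0

/-! ## Non-intersecting paths on the directed graph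

The graph has the vertices `(i, y)`, `0 ≤ i ≤ 2N`, `y ∈ ℤ`, and the edges
`(2m, y) → (2m+1, y)`, `(2m, y) → (2m+1, y-1)`, `(2m+1, y) → (2m+1, y-1)` and
`(2m+1, y) → (2m+2, y)` for `0 ≤ m < N`. A path from level `0` to level `2N` is determined by the
heights at which it first reaches the successive levels. -/

/-- The height of the `j`-th path when it reaches level `2m`. -/
def evenHeight {N K : ℕ} (u : Config (2 * N) K) (m : Fin N) (j : Fin K) : ℤ :=
  u ⟨2 * m, by omega⟩ j

/-- The height of the `j`-th path when it reaches level `2m+1`. -/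
def oddHeight {N K : ℕ} (u : Config (2 * N) K) (m : Fin N) (j : Fin K) : ℤ :=
  u ⟨2 * m + 1, by omega⟩ j

/-- The height of the `j`-th path when it leaves level `2m+1` for level `2m+2`, which is also its
height at level `2m+2`. -/
def nextHeight {N K : ℕ} (u : Config (2 * N) K) (m : Fin N) (j : Fin K) : ℤ :=
  u ⟨2 * m + 2, by omega⟩ j

/-- The vertices of the graph on the `j`-th path. -/
def pathVertices {N K : ℕ} (u : Config (2 * N) K) (j : Fin K) : Set (ℕ × ℤ) :=
  {q | (∃ i : Fin (2 * N + 1), q = ((i : ℕ), u i j)) ∨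
    ∃ m : Fin N, q.1 = 2 * m + 1 ∧ nextHeight u m j ≤ q.2 ∧ q.2 ≤ oddHeight u m j}

/-- `u` describes `K` paths on the graph, from `(0, j)` to `(2N, s + j)` for `0 ≤ j < K`, no two of
which have a common vertex. -/
structure IsNonIntersecting {N K : ℕ} (s : ℤ) (u : Config (2 * N) K) : Prop where
  endpoints : HasEndpoints s u
  odd_step : ∀ m j, oddHeight u m j = evenHeight u m j ∨ oddHeight u m j = evenHeight u m j - 1
  even_step : ∀ m j, nextHeight u m j ≤ oddHeight u m j
  disjoint : ∀ j k, j ≠ k → Disjoint (pathVertices u j) (pathVertices u k)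

/-- The space of collections of `K` non-intersecting paths. -/
abbrev NonIntersectingPaths (N K : ℕ) (s : ℤ) : Type :=
  {u : Config (2 * N) K // IsNonIntersecting s u}

/-- The paths `u` are those drawn on the dominoes of the tiling `S` of the extended domain:
each West domino carries an edge `(2m, y) → (2m+1, y)`, each South domino an edge
`(2m, y) → (2m+1, y-1)`, each East domino an edge `(2m+1, y) → (2m+1, y-1)`, North dominoes carry
nothing, and the paths use no other edges apart from the edges `(2m+1, y) → (2m+2, y)`. The
coordinate `x` of a domino and the height `y` are related by `y = x + K - N`. -/
structure IsDrawing {N K : ℕ} (S : DominoTiling N (extendedDomain N K))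
    (u : Config (2 * N) K) : Prop where
  west : ∀ (m : Fin N) (x : ℤ), (TileKind.west, (m : ℤ), x) ∈ S.tiles ↔
    ∃ j, evenHeight u m j = x + K - N ∧ oddHeight u m j = x + K - N
  south : ∀ (m : Fin N) (x : ℤ), (TileKind.south, (m : ℤ), x) ∈ S.tiles ↔
    ∃ j, evenHeight u m j = x + K - N ∧ oddHeight u m j = x + K - N - 1
  east : ∀ (m : Fin N) (x : ℤ), (TileKind.east, (m : ℤ) + 1, x) ∈ S.tiles ↔
    ∃ j, nextHeight u m j < x + K - N ∧ x + K - N ≤ oddHeight u m j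

end

end AztecPaths

open AztecPaths MeasureTheory

/-!
The configurations of positive weight are identified with non-intersecting paths on one side, and
with domino tilings on the other, up to permutations of labels.

For points that increase with their label on both levels, the determinant of one step is the
product of its diagonal entries if the points can be joined by disjoint paths, and zero otherwise
(`det_transition_odd`, `det_transition_even`, `gap_of_det_transition_even_ne_zero`). A permutation
of the labels of an interior level changes the sign of two determinants (`detWeight_relabel`). So
the product of determinants is carried by the non-intersecting paths with permuted labels, and its
value is the product of the weights of the edges.

On the side of the tilings, each height of a level shows either a path, with a West or South
domino, or no path, with a North or East domino. If a tiling is given, then the points of each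
level are read off from the West and South dominoes. Going from an odd level to the next one, the
numbers of points below a given height differ by one where there is an East domino, and agree
elsewhere (`card_evenLevel_succ`). For the sorted points this means that they interlace, and that
the East dominoes fill the gaps (`interlacing_of_card`), which is what non-intersecting paths look
like (`isNonIntersecting_of_interlacing`). Conversely, the dominoes on given paths, with North
dominoes at the heights that no path visits, cover every square once (`onPaths_black`,
`onPaths_white`). Thus drawing is a bijection (`exists_drawing_equiv`), and the weight of the
paths is that of the tiling (`detWeight_eq_tilingWeight`).

A tiling of the extended domain decouples by counting: all neighbors, in the extended domain, of
colored squares of the Aztec diamond lie in the Aztec diamond, and it contains equally many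
squares of both colors (`black_nonneg_of_white`). This forces the South dominoes of the corridor, diagonal by diagonal
(`corridor_forced`), and leaves an arbitrary tiling of the lower diamond (`decouple`).

Together, the configurations of positive weight are parametrized by a tiling of the Aztec diamond,
a tiling of the lower diamond, and permutations of labels, and the weight is that of the first
tiling times a factor that depends on the other data only. So the first tiling has the weighted
tiling measure as its law (`map_normalizedMeasure`).
-/

namespace AztecPaths

/-! ### Dominoes in coordinates -/

/-- The uncolored square with coordinates `(m, x)`: the one above the colored square `(m, x)`. -/
def whiteSquare (N : ℕ) (m x : ℤ) : ℤ × ℤ := (m - x + N - 1, m + x + 1)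

/-- The coordinates of the uncolored square of a domino. -/
def Tile.white : Tile → ℤ × ℤ
  | (.north, m, x) => (m - 1, x)
  | (.west, m, x) => (m, x)
  | (.south, m, x) => (m, x - 1)
  | (.east, m, x) => (m - 1, x - 1)

theorem Tile.cells_eq (N : ℕ) (t : Tile) :
    Tile.cells N t =
      {blackSquare N t.2.1 t.2.2, whiteSquare N (Tile.white t).1 (Tile.white t).2} := by
  obtain ⟨k, m, x⟩ := t
  cases k <;> simp only [Tile.cells, Tile.white, blackSquare, whiteSquare, TileKind.offset] <;>
    congr 2 <;> ext <;> simp only [Prod.fst_add, Prod.snd_add] <;> ring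

theorem blackSquare_inj {N : ℕ} {m x m' x' : ℤ} :
    blackSquare N m x = blackSquare N m' x' ↔ m = m' ∧ x = x' := by
  simp only [blackSquare, Prod.mk.injEq]
  constructor
  · rintro ⟨h, h'⟩; omega
  · rintro ⟨rfl, rfl⟩; simp

theorem whiteSquare_inj {N : ℕ} {m x m' x' : ℤ} :
    whiteSquare N m x = whiteSquare N m' x' ↔ m = m' ∧ x = x' := by
  simp only [whiteSquare, Prod.mk.injEq]
  constructor
  · rintro ⟨h, h'⟩; omega
  · rintro ⟨rfl, rfl⟩; simp

theorem blackSquare_ne_whiteSquare {N : ℕ} {m x m' x' : ℤ} :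
    blackSquare N m x ≠ whiteSquare N m' x' := by
  simp only [blackSquare, whiteSquare, ne_eq, Prod.mk.injEq]
  omega

theorem exists_black_or_white (N : ℕ) (s : ℤ × ℤ) :
    (∃ m x, s = blackSquare N m x) ∨ ∃ m x, s = whiteSquare N m x := by
  obtain ⟨a, b⟩ := s
  simp only [blackSquare, whiteSquare, Prod.mk.injEq]
  rcases Int.even_or_odd' (a + b - N + 1) with ⟨k, hk | hk⟩
  · exact Or.inl ⟨k, b - k, by omega, by omega⟩
  · exact Or.inr ⟨k, b - k - 1, by omega, by omega⟩

theorem black_mem_cells {N : ℕ} {m x : ℤ} {t : Tile} :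
    blackSquare N m x ∈ Tile.cells N t ↔ t.2 = (m, x) := by
  rw [Tile.cells_eq]
  simp only [Set.mem_insert_iff, Set.mem_singleton_iff, blackSquare_inj,
    blackSquare_ne_whiteSquare, or_false, Prod.ext_iff (x := t.2)]
  tauto

theorem white_mem_cells {N : ℕ} {m x : ℤ} {t : Tile} :
    whiteSquare N m x ∈ Tile.cells N t ↔ Tile.white t = (m, x) := by
  rw [Tile.cells_eq]
  simp only [Set.mem_insert_iff, Set.mem_singleton_iff, whiteSquare_inj,
    blackSquare_ne_whiteSquare.symm, false_or, Prod.ext_iff (x := Tile.white t)]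
  tauto

theorem cells_subset_iff {N : ℕ} {t : Tile} {R : Set (ℤ × ℤ)} :
    Tile.cells N t ⊆ R ↔ blackSquare N t.2.1 t.2.2 ∈ R ∧
      whiteSquare N (Tile.white t).1 (Tile.white t).2 ∈ R := by
  rw [Tile.cells_eq, Set.insert_subset_iff, Set.singleton_subset_iff]

theorem cells_nonempty (N : ℕ) (t : Tile) : (Tile.cells N t).Nonempty :=
  ⟨_, black_mem_cells.2 rfl⟩

/-- A set of dominoes tiles a region as soon as it covers each colored and each uncolored square of
the region exactly once. -/
theorem existsUnique_cover {N : ℕ} {R : Set (ℤ × ℤ)} {P : Tile → Prop}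
    (hb : ∀ m x, blackSquare N m x ∈ R → ∃! t : Tile, P t ∧ t.2 = (m, x))
    (hw : ∀ m x, whiteSquare N m x ∈ R → ∃! t : Tile, P t ∧ Tile.white t = (m, x)) :
    ∀ s ∈ R, ∃! t : Tile, P t ∧ s ∈ Tile.cells N t := by
  intro s hs
  rcases exists_black_or_white N s with ⟨m, x, rfl⟩ | ⟨m, x, rfl⟩
  · simpa only [black_mem_cells] using hb m x hs
  · simpa only [white_mem_cells] using hw m x hs

instance : Finite TileKind :=
  Finite.of_surjective (fun i : Fin 4 => ![TileKind.north, .west, .south, .east] i) (by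
    rintro (_ | _ | _ | _)
    exacts [⟨0, rfl⟩, ⟨1, rfl⟩, ⟨2, rfl⟩, ⟨3, rfl⟩])

noncomputable instance : DecidableEq TileKind := Classical.decEq _

theorem finite_tiles_subset (N : ℕ) {R : Set (ℤ × ℤ)} (hR : R.Finite) :
    {t : Tile | Tile.cells N t ⊆ R}.Finite := by
  refine Set.Finite.subset ((Set.finite_univ (α := TileKind)).prod
    (hR.preimage (f := fun q : ℤ × ℤ => blackSquare N q.1 q.2) ?_)) ?_
  · rintro ⟨a, b⟩ _ ⟨a', b'⟩ _ h
    obtain ⟨rfl, rfl⟩ := blackSquare_inj.1 h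
    rfl
  · intro t ht
    exact ⟨Set.mem_univ _, (cells_subset_iff.1 ht).1⟩

theorem finite_dominoTiling (N : ℕ) {R : Set (ℤ × ℤ)} (hR : R.Finite) :
    Finite (DominoTiling N R) := by
  have := (finite_tiles_subset N hR).finite_subsets.to_subtype
  refine Finite.of_injective (β := {b : Set Tile | b ⊆ {t : Tile | Tile.cells N t ⊆ R}})
    (fun S => ⟨(S.tiles : Set Tile), fun t ht => S.inside t (by simpa using ht)⟩) fun S S' h => ?_
  exact DominoTiling.ext (Finset.coe_injective (congrArg Subtype.val h))

/-- The tiling of a finite region by the dominoes with a given property. -/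
noncomputable def DominoTiling.ofPred {N : ℕ} {R : Set (ℤ × ℤ)} (hR : R.Finite) (P : Tile → Prop)
    (hP : ∀ t, P t → Tile.cells N t ⊆ R)
    (hc : ∀ s ∈ R, ∃! t : Tile, P t ∧ s ∈ Tile.cells N t) : DominoTiling N R where
  tiles := (Set.Finite.subset (s := {t | Tile.cells N t ⊆ R}) (t := {t | P t})
    (finite_tiles_subset N hR) hP).toFinset
  inside t ht := hP t (by simpa using ht)
  covers s hs := by simpa using hc s hs

@[simp]
theorem DominoTiling.mem_ofPred {N : ℕ} {R : Set (ℤ × ℤ)} (hR : R.Finite) (P : Tile → Prop)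
    (hP : ∀ t, P t → Tile.cells N t ⊆ R)
    (hc : ∀ s ∈ R, ∃! t : Tile, P t ∧ s ∈ Tile.cells N t) {t : Tile} :
    t ∈ (DominoTiling.ofPred hR P hP hc).tiles ↔ P t := by
  simp [DominoTiling.ofPred]

namespace DominoTiling

variable {N : ℕ} {R R' : Set (ℤ × ℤ)} (S : DominoTiling N R)

theorem eq_of_mem_cells {s : ℤ × ℤ} {t t' : Tile} (ht : t ∈ S.tiles) (ht' : t' ∈ S.tiles)
    (h : s ∈ Tile.cells N t) (h' : s ∈ Tile.cells N t') : t = t' :=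
  (S.covers s (S.inside t ht h)).unique ⟨ht, h⟩ ⟨ht', h'⟩

theorem eq_of_black {t t' : Tile} (ht : t ∈ S.tiles) (ht' : t' ∈ S.tiles) (h : t.2 = t'.2) :
    t = t' :=
  S.eq_of_mem_cells (s := blackSquare N t.2.1 t.2.2) ht ht' (black_mem_cells.2 rfl)
    (black_mem_cells.2 h.symm)

theorem eq_of_white {t t' : Tile} (ht : t ∈ S.tiles) (ht' : t' ∈ S.tiles)
    (h : Tile.white t = Tile.white t') : t = t' :=
  S.eq_of_mem_cells (s := whiteSquare N (Tile.white t).1 (Tile.white t).2) ht ht'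
    (white_mem_cells.2 rfl) (white_mem_cells.2 h.symm)

theorem exists_kind {m x : ℤ} (h : blackSquare N m x ∈ R) :
    (TileKind.north, m, x) ∈ S.tiles ∨ (TileKind.west, m, x) ∈ S.tiles ∨
      (TileKind.south, m, x) ∈ S.tiles ∨ (TileKind.east, m, x) ∈ S.tiles := by
  obtain ⟨⟨k, q⟩, ⟨ht, h'⟩, -⟩ := S.covers _ h
  obtain rfl : q = (m, x) := black_mem_cells.1 h'
  cases k <;> tauto

theorem exists_white {m x : ℤ} (h : whiteSquare N m x ∈ R) :
    (TileKind.north, m + 1, x) ∈ S.tiles ∨ (TileKind.west, m, x) ∈ S.tiles ∨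
      (TileKind.south, m, x + 1) ∈ S.tiles ∨ (TileKind.east, m + 1, x + 1) ∈ S.tiles := by
  obtain ⟨⟨k, m', x'⟩, ⟨ht, h'⟩, -⟩ := S.covers _ h
  have h' := white_mem_cells.1 h'
  cases k <;> simp only [Tile.white, Prod.mk.injEq] at h' <;> obtain ⟨rfl, rfl⟩ := h' <;>
    simp [ht]

/-- A tiling of `R` restricts to a tiling of a smaller region `R'` if none of its dominoes crosses
the boundary of `R'`. -/
noncomputable def restrict (hR' : R'.Finite) (hsub : R' ⊆ R)
    (h : ∀ t ∈ S.tiles, ∀ s ∈ R', s ∈ Tile.cells N t → Tile.cells N t ⊆ R') :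
    DominoTiling N R' :=
  ofPred hR' (fun t => t ∈ S.tiles ∧ Tile.cells N t ⊆ R') (fun _ ht => ht.2) (by
    intro s hs
    obtain ⟨t, ⟨ht, hst⟩, huniq⟩ := S.covers s (hsub hs)
    exact ⟨t, ⟨⟨ht, h t ht s hs hst⟩, hst⟩, fun t' ht' => huniq t' ⟨ht'.1.1, ht'.2⟩⟩)

theorem mem_restrict (hR' : R'.Finite) (hsub : R' ⊆ R)
    (h : ∀ t ∈ S.tiles, ∀ s ∈ R', s ∈ Tile.cells N t → Tile.cells N t ⊆ R') {t : Tile} :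
    t ∈ (S.restrict hR' hsub h).tiles ↔ t ∈ S.tiles ∧ Tile.cells N t ⊆ R' :=
  mem_ofPred _ _ _ _

/-- Tilings of two disjoint regions form a tiling of the union. -/
noncomputable def union (hd : Disjoint R R') (S' : DominoTiling N R') :
    DominoTiling N (R ∪ R') where
  tiles := S.tiles ∪ S'.tiles
  inside t ht := by
    rcases Finset.mem_union.1 ht with ht | ht
    · exact (S.inside t ht).trans Set.subset_union_left
    · exact (S'.inside t ht).trans Set.subset_union_right
  covers s hs := by
    rcases hs with hs | hs
    · obtain ⟨t, ⟨ht, hst⟩, huniq⟩ := S.covers s hs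
      refine ⟨t, ⟨Finset.mem_union_left _ ht, hst⟩, fun t' ⟨ht', hst'⟩ => ?_⟩
      rcases Finset.mem_union.1 ht' with ht' | ht'
      · exact huniq t' ⟨ht', hst'⟩
      · exact (Set.disjoint_left.1 hd hs (S'.inside t' ht' hst')).elim
    · obtain ⟨t, ⟨ht, hst⟩, huniq⟩ := S'.covers s hs
      refine ⟨t, ⟨Finset.mem_union_right _ ht, hst⟩, fun t' ⟨ht', hst'⟩ => ?_⟩
      rcases Finset.mem_union.1 ht' with ht' | ht'
      · exact (Set.disjoint_left.1 hd (S.inside t' ht' hst') hs).elim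
      · exact huniq t' ⟨ht', hst'⟩

theorem mem_union (hd : Disjoint R R') (S' : DominoTiling N R') {t : Tile} :
    t ∈ (S.union hd S').tiles ↔ t ∈ S.tiles ∨ t ∈ S'.tiles := by
  classical
  simp [union]

theorem tilingWeight_union (hd : Disjoint R R') (S' : DominoTiling N R') (b c d : ℤ → ℤ → ℝ) :
    tilingWeight b c d (S.union hd S') = tilingWeight b c d S * tilingWeight b c d S' := by
  classical
  refine Finset.prod_union (Finset.disjoint_left.2 fun t ht ht' => ?_)
  obtain ⟨s, hs⟩ := cells_nonempty N t
  exact Set.disjoint_left.1 hd (S.inside t ht hs) (S'.inside t ht' hs)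

end DominoTiling

/-! ### The regions in coordinates -/

theorem black_mem_aztecDiamond {N : ℕ} {m x : ℤ} :
    blackSquare N m x ∈ aztecDiamond N ↔ 0 ≤ m ∧ m ≤ N ∧ 0 ≤ x ∧ x ≤ N - 1 := by
  simp only [blackSquare, aztecDiamond, Set.mem_ofPred_eq, abs_le]
  omega

theorem white_mem_aztecDiamond {N : ℕ} {m x : ℤ} :
    whiteSquare N m x ∈ aztecDiamond N ↔ 0 ≤ m ∧ m ≤ N - 1 ∧ -1 ≤ x ∧ x ≤ N - 1 := by
  simp only [whiteSquare, aztecDiamond, Set.mem_ofPred_eq, abs_le]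
  omega

theorem black_mem_corridor {N K : ℕ} {m x : ℤ} :
    blackSquare N m x ∈ corridor N K ↔ 0 ≤ m ∧ m ≤ N - 1 ∧ (N : ℤ) - K ≤ x ∧ x ≤ -1 := by
  simp only [blackSquare, corridor, Set.mem_ofPred_eq]
  omega

theorem white_mem_corridor {N K : ℕ} {m x : ℤ} :
    whiteSquare N m x ∈ corridor N K ↔ 0 ≤ m ∧ m ≤ N - 1 ∧ (N : ℤ) - 1 - K ≤ x ∧ x ≤ -2 := by
  simp only [whiteSquare, corridor, Set.mem_ofPred_eq]
  omega

theorem black_mem_lowerDiamond {N K : ℕ} {m x : ℤ} :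
    blackSquare N m x ∈ lowerDiamond N K ↔
      1 ≤ m ∧ m ≤ N - 1 ∧ -(K : ℤ) ≤ x ∧ x ≤ N - K - 1 := by
  simp only [blackSquare, lowerDiamond, aztecDiamond, Set.mem_ofPred_eq, abs_le]
  omega

theorem white_mem_lowerDiamond {N K : ℕ} {m x : ℤ} :
    whiteSquare N m x ∈ lowerDiamond N K ↔
      0 ≤ m ∧ m ≤ N - 1 ∧ -(K : ℤ) ≤ x ∧ x ≤ N - K - 2 := by
  simp only [whiteSquare, lowerDiamond, aztecDiamond, Set.mem_ofPred_eq, abs_le]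
  omega

theorem black_mem_extendedDomain {N K : ℕ} (hK : N ≤ K) {m x : ℤ} :
    blackSquare N m x ∈ extendedDomain N K ↔ 0 ≤ m ∧ m ≤ N ∧ -(K : ℤ) ≤ x ∧ x ≤ N - 1 ∧
      (m = 0 → (N : ℤ) - K ≤ x) ∧ (m = N → 0 ≤ x) := by
  simp only [extendedDomain, Set.mem_union, black_mem_aztecDiamond, black_mem_corridor,
    black_mem_lowerDiamond]
  omega

theorem white_mem_extendedDomain {N K : ℕ} (hK : N ≤ K) {m x : ℤ} :
    whiteSquare N m x ∈ extendedDomain N K ↔ 0 ≤ m ∧ m ≤ N - 1 ∧ -(K : ℤ) ≤ x ∧ x ≤ N - 1 := by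
  simp only [extendedDomain, Set.mem_union, white_mem_aztecDiamond, white_mem_corridor,
    white_mem_lowerDiamond]
  omega

theorem disjoint_aztecDiamond_corridor (N K : ℕ) :
    Disjoint (aztecDiamond N) (corridor N K) := by
  refine Set.disjoint_left.2 fun s => ?_
  simp only [aztecDiamond, corridor, Set.mem_ofPred_eq, abs_le]
  omega

theorem disjoint_lowerDiamond {N K : ℕ} (hK : N ≤ K) :
    Disjoint (aztecDiamond N ∪ corridor N K) (lowerDiamond N K) := by
  refine Set.disjoint_left.2 fun s => ?_
  simp only [aztecDiamond, corridor, lowerDiamond, Set.mem_union, Set.mem_ofPred_eq, abs_le]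
  omega

theorem finite_extendedDomain (N K : ℤ) : (extendedDomain N K).Finite := by
  refine (Set.finite_Icc ((-(3 * |N| + 3 * |K| + 9), -(3 * |N| + 3 * |K| + 9)) : ℤ × ℤ)
    (3 * |N| + 3 * |K| + 9, 3 * |N| + 3 * |K| + 9)).subset ?_
  rintro ⟨a, b⟩ h
  have h1 := abs_nonneg N
  have h2 := abs_nonneg K
  have h3 := le_abs_self N
  have h4 := le_abs_self K
  have h5 := neg_abs_le N
  have h6 := neg_abs_le K
  simp only [extendedDomain, aztecDiamond, corridor, lowerDiamond, Set.mem_union, Set.mem_ofPred_eq,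
    abs_le] at h
  simp only [Set.mem_Icc, Prod.mk_le_mk]
  generalize |N| = A at *
  generalize |K| = B at *
  omega

theorem finite_aztecDiamond (N : ℤ) : (aztecDiamond N).Finite :=
  (finite_extendedDomain N 0).subset fun _ h => Or.inl (Or.inl h)

theorem finite_lowerDiamond (N K : ℤ) : (lowerDiamond N K).Finite :=
  (finite_extendedDomain N K).subset fun _ h => Or.inr h

/-! ### Decoupling of the extended domain -/

section Decoupling

variable {N K : ℕ} (hK : N ≤ K) (S : DominoTiling N (extendedDomain N K))
include hK

theorem black_bounds {t : Tile} (ht : t ∈ S.tiles) :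
    0 ≤ t.2.1 ∧ t.2.1 ≤ N ∧ -(K : ℤ) ≤ t.2.2 ∧ t.2.2 ≤ N - 1 ∧
      (t.2.1 = 0 → (N : ℤ) - K ≤ t.2.2) ∧ (t.2.1 = N → 0 ≤ t.2.2) :=
  (black_mem_extendedDomain hK).1 (cells_subset_iff.1 (S.inside t ht)).1

theorem white_bounds {t : Tile} (ht : t ∈ S.tiles) :
    0 ≤ (Tile.white t).1 ∧ (Tile.white t).1 ≤ N - 1 ∧ -(K : ℤ) ≤ (Tile.white t).2 ∧
      (Tile.white t).2 ≤ N - 1 :=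
  (white_mem_extendedDomain hK).1 (cells_subset_iff.1 (S.inside t ht)).2

/-- The dominoes on the `N (N + 1)` colored squares of the Aztec diamond cover uncolored squares
of the Aztec diamond, of which there are equally many. So they cover all of them. -/
theorem black_nonneg_of_white {t : Tile} (ht : t ∈ S.tiles) (hx : -1 ≤ (Tile.white t).2) :
    0 ≤ t.2.2 := by
  classical
  set A : Finset (ℤ × ℤ) := Finset.Icc (0 : ℤ) N ×ˢ Finset.Icc (0 : ℤ) (N - 1)
  set W : Finset (ℤ × ℤ) := Finset.Icc (0 : ℤ) (N - 1) ×ˢ Finset.Icc (-1 : ℤ) (N - 1)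
  have hcover : ∀ q : ℤ × ℤ, q ∈ A → ∃ t ∈ S.tiles, t.2 = q := by
    rintro ⟨m, x⟩ hq
    simp only [A, Finset.mem_product, Finset.mem_Icc] at hq
    have := S.exists_kind (m := m) (x := x) ((black_mem_extendedDomain hK).2 (by omega))
    rcases this with h | h | h | h <;> exact ⟨_, h, rfl⟩
  have : Nonempty Tile := ⟨t⟩
  choose! τ hτ hτ2 using hcover
  -- `τ q` is the domino on the colored square `q`.
  have hmaps : Set.MapsTo (fun q => Tile.white (τ q)) A W := by
    intro q hq
    have h1 := white_bounds hK S (hτ q hq)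
    have h2 := hτ2 q hq
    change Tile.white (τ q) ∈ _
    generalize τ q = t' at h1 h2 ⊢
    subst h2
    obtain ⟨k, m, x⟩ := t'
    simp only [A, W, Finset.coe_product, Finset.coe_Icc, Set.mem_prod, Set.mem_Icc] at hq ⊢
    cases k <;> simp only [Tile.white] at h1 ⊢ <;> omega
  have hinj : Set.InjOn (fun q => Tile.white (τ q)) A := by
    intro q hq q' hq' h
    rw [← hτ2 q hq, ← hτ2 q' hq', S.eq_of_white (hτ q hq) (hτ q' hq') h]
  have hcard : W.card ≤ A.card := by
    simp only [A, W, Finset.card_product, Int.card_Icc]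
    have e1 : ((N : ℤ) - 1 + 1 - 0).toNat = N := by omega
    have e2 : ((N : ℤ) - 1 + 1 - -1).toNat = N + 1 := by omega
    have e3 : ((N : ℤ) + 1 - 0).toNat = N + 1 := by omega
    rw [e1, e2, e3, mul_comm]
  have hsurj := Finset.surjOn_of_injOn_of_card_le _ hmaps hinj hcard
  have hw := white_bounds hK S ht
  obtain ⟨q, hq, hqt⟩ := hsurj (show Tile.white t ∈ (W : Set (ℤ × ℤ)) by
    simp only [W, Finset.coe_product, Finset.coe_Icc, Set.mem_prod, Set.mem_Icc]
    omega)
  obtain rfl := S.eq_of_white (hτ q hq) ht hqt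
  rw [hτ2 q hq]
  simp only [A, Finset.coe_product, Finset.coe_Icc, Set.mem_prod, Set.mem_Icc] at hq
  exact hq.2.1

/-- The diagonals of the corridor, from the Aztec diamond downwards, are filled with South dominoes:
the uncolored squares above the diagonal are used up. -/
theorem corridor_forced (k : ℕ) (hk : k ≤ K - N) :
    (∀ t ∈ S.tiles, -1 - (k : ℤ) ≤ (Tile.white t).2 → -(k : ℤ) ≤ t.2.2) ∧
      (1 ≤ k → ∀ m : ℕ, m < N → (TileKind.south, (m : ℤ), -(k : ℤ)) ∈ S.tiles) := by
  induction k with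
  | zero =>
    refine ⟨fun t ht h => ?_, fun h => absurd h (by norm_num)⟩
    simpa using black_nonneg_of_white hK S ht (by simpa using h)
  | succ k ih =>
    have ih := (ih (by omega)).1
    have hsouth : ∀ m : ℕ, m < N → (TileKind.south, (m : ℤ), -((k + 1 : ℕ) : ℤ)) ∈ S.tiles := by
      intro m
      -- Two neighbors of a colored square of this diagonal are used up by the dominoes above.
      -- A third one is covered by the previous South domino, or is outside of the domain at the
      -- beginning.
      induction m with
      | zero =>
        intro hm
        rcases S.exists_kind (m := ((0 : ℕ) : ℤ)) (x := -((k + 1 : ℕ) : ℤ))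
          ((black_mem_extendedDomain hK).2 (by omega)) with h | h | h | h
        · have := white_bounds hK S h
          simp only [Tile.white] at this
          omega
        · have := ih _ h
          simp only [Tile.white] at this
          omega
        · exact h
        · have := white_bounds hK S h
          simp only [Tile.white] at this
          omega
      | succ m ihm =>
        intro hm
        rcases S.exists_kind (m := ((m + 1 : ℕ) : ℤ)) (x := -((k + 1 : ℕ) : ℤ))
          ((black_mem_extendedDomain hK).2 (by omega)) with h | h | h | h
        · have := ih _ h
          simp only [Tile.white] at this
          omega
        · have := ih _ h
          simp only [Tile.white] at this
          omega
        · exact h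
        · have := S.eq_of_white h (ihm (by omega)) (by simp [Tile.white])
          simp at this
    refine ⟨fun t ht h => ?_, fun _ => hsouth⟩
    by_cases h' : -1 - (k : ℤ) ≤ (Tile.white t).2
    · have := ih t ht h'
      omega
    · have hw := white_bounds hK S ht
      have := S.eq_of_white ht (hsouth (Tile.white t).1.toNat (by omega)) (by
        change Tile.white t = (((Tile.white t).1.toNat : ℤ), -((k + 1 : ℕ) : ℤ) - 1)
        rw [Prod.ext_iff]
        dsimp only
        omega)
      rw [this]

theorem tile_decoupled {t : Tile} (ht : t ∈ S.tiles) :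
    Tile.cells N t ⊆ aztecDiamond N ∨ (Tile.cells N t ⊆ corridor N K ∧ t.1 = TileKind.south) ∨
      Tile.cells N t ⊆ lowerDiamond N K := by
  have hb := black_bounds hK S ht
  have hw := white_bounds hK S ht
  by_cases h0 : 0 ≤ t.2.2
  · left
    rw [cells_subset_iff, black_mem_aztecDiamond, white_mem_aztecDiamond]
    obtain ⟨k, m, x⟩ := t
    cases k <;> simp only [Tile.white] at * <;> omega
  right
  by_cases h1 : (N : ℤ) - K ≤ t.2.2
  · left
    have hs := (corridor_forced hK S (-t.2.2).toNat (by omega)).2 (by omega) t.2.1.toNat (by omega)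
    have : t = _ := S.eq_of_black ht hs (by simp only [Prod.ext_iff]; omega)
    have hk : t.1 = TileKind.south := by rw [this]
    refine ⟨?_, hk⟩
    rw [cells_subset_iff, black_mem_corridor, white_mem_corridor]
    obtain ⟨k, m, x⟩ := t
    obtain rfl : k = TileKind.south := hk
    simp only [Tile.white] at *
    omega
  · right
    have h2 := (corridor_forced hK S (K - N) le_rfl).1 t ht
    rw [cells_subset_iff, black_mem_lowerDiamond, white_mem_lowerDiamond]
    obtain ⟨k, m, x⟩ := t
    cases k <;> simp only [Tile.white] at * <;> omega

/-- The part inside the Aztec diamond of a tiling of the extended domain. -/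
noncomputable def upperPart : DominoTiling N (aztecDiamond N) :=
  S.restrict (finite_aztecDiamond N) (fun _ h => Or.inl (Or.inl h)) (by
    intro t ht s hs hst
    rcases tile_decoupled hK S ht with h | ⟨h, -⟩ | h
    · exact h
    · exact (Set.disjoint_left.1 (disjoint_aztecDiamond_corridor N K) hs (h hst)).elim
    · exact (Set.disjoint_left.1 (disjoint_lowerDiamond hK) (Or.inl hs) (h hst)).elim)

theorem mem_upperPart {t : Tile} :
    t ∈ (upperPart hK S).tiles ↔ t ∈ S.tiles ∧ Tile.cells N t ⊆ aztecDiamond N :=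
  DominoTiling.mem_restrict _ _ _ _

/-- The part inside the lower diamond of a tiling of the extended domain. -/
noncomputable def lowerPart : DominoTiling N (lowerDiamond N K) :=
  S.restrict (finite_lowerDiamond N K) (fun _ h => Or.inr h) (by
    intro t ht s hs hst
    rcases tile_decoupled hK S ht with h | ⟨h, -⟩ | h
    · exact (Set.disjoint_left.1 (disjoint_lowerDiamond hK) (Or.inl (h hst)) hs).elim
    · exact (Set.disjoint_left.1 (disjoint_lowerDiamond hK) (Or.inr (h hst)) hs).elim
    · exact h)

theorem mem_lowerPart {t : Tile} :
    t ∈ (lowerPart hK S).tiles ↔ t ∈ S.tiles ∧ Tile.cells N t ⊆ lowerDiamond N K :=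
  DominoTiling.mem_restrict _ _ _ _

end Decoupling

/-- The tiling of the corridor by South dominoes. -/
noncomputable def corridorTiling (N K : ℕ) : DominoTiling N (corridor N K) :=
  .ofPred ((finite_extendedDomain N K).subset fun _ h => Or.inl (Or.inr h))
    (fun t => t.1 = TileKind.south ∧ Tile.cells N t ⊆ corridor N K) (fun _ h => h.2)
    (existsUnique_cover
      (by
        intro m x h
        rw [black_mem_corridor] at h
        refine ⟨(TileKind.south, m, x), ⟨⟨rfl, cells_subset_iff.2 ⟨?_, ?_⟩⟩, rfl⟩, ?_⟩
        · rwa [black_mem_corridor]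
        · rw [white_mem_corridor]
          simp only [Tile.white]
          omega
        · rintro ⟨k, q⟩ ⟨⟨rfl, -⟩, rfl⟩
          rfl)
      (by
        intro m x h
        rw [white_mem_corridor] at h
        refine ⟨(TileKind.south, m, x + 1), ⟨⟨rfl, cells_subset_iff.2 ⟨?_, ?_⟩⟩, ?_⟩, ?_⟩
        · rw [black_mem_corridor]
          dsimp only
          omega
        · rw [white_mem_corridor]
          simp only [Tile.white]
          omega
        · simp [Tile.white]
        · rintro ⟨k, m', x'⟩ ⟨⟨rfl, -⟩, h'⟩
          simp only [Tile.white, Prod.mk.injEq] at h'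
          obtain ⟨rfl, rfl⟩ := h'
          simp))

theorem mem_corridorTiling {N K : ℕ} {t : Tile} :
    t ∈ (corridorTiling N K).tiles ↔ t.1 = TileKind.south ∧ Tile.cells N t ⊆ corridor N K :=
  DominoTiling.mem_ofPred _ _ _ _

/-- A tiling of the Aztec diamond and one of the lower diamond combine with the South dominoes of
the corridor. -/
noncomputable def glue {N K : ℕ} (hK : N ≤ K) (A : DominoTiling N (aztecDiamond N))
    (B : DominoTiling N (lowerDiamond N K)) : DominoTiling N (extendedDomain N K) :=
  (A.union (disjoint_aztecDiamond_corridor N K) (corridorTiling N K)).union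
    (disjoint_lowerDiamond hK) B

theorem mem_glue {N K : ℕ} (hK : N ≤ K) (A : DominoTiling N (aztecDiamond N))
    (B : DominoTiling N (lowerDiamond N K)) {t : Tile} :
    t ∈ (glue hK A B).tiles ↔ (t ∈ A.tiles ∨ t ∈ (corridorTiling N K).tiles) ∨ t ∈ B.tiles := by
  simp only [glue, DominoTiling.mem_union]

theorem tilingWeight_glue {N K : ℕ} (hK : N ≤ K) (A : DominoTiling N (aztecDiamond N))
    (B : DominoTiling N (lowerDiamond N K)) (b c d : ℤ → ℤ → ℝ) :
    tilingWeight b c d (glue hK A B) =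
      tilingWeight b c d A * (tilingWeight b c d (corridorTiling N K) * tilingWeight b c d B) := by
  rw [← mul_assoc, ← DominoTiling.tilingWeight_union, ← DominoTiling.tilingWeight_union]
  rfl

/-- The tilings of the extended domain are the pairs of tilings of the two Aztec diamonds. -/
noncomputable def decouple {N K : ℕ} (hK : N ≤ K) :
    DominoTiling N (aztecDiamond N) × DominoTiling N (lowerDiamond N K) ≃
      DominoTiling N (extendedDomain N K) where
  toFun q := glue hK q.1 q.2
  invFun S := (upperPart hK S, lowerPart hK S)
  left_inv := by
    rintro ⟨A, B⟩
    have h1 : ∀ t, Tile.cells N t ⊆ aztecDiamond N → ¬ Tile.cells N t ⊆ corridor N K :=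
      fun t h h' => (cells_nonempty N t).elim fun s hs =>
        Set.disjoint_left.1 (disjoint_aztecDiamond_corridor N K) (h hs) (h' hs)
    have h2 : ∀ t, Tile.cells N t ⊆ aztecDiamond N → ¬ Tile.cells N t ⊆ lowerDiamond N K :=
      fun t h h' => (cells_nonempty N t).elim fun s hs =>
        Set.disjoint_left.1 (disjoint_lowerDiamond hK) (Or.inl (h hs)) (h' hs)
    have h3 : ∀ t, Tile.cells N t ⊆ corridor N K → ¬ Tile.cells N t ⊆ lowerDiamond N K :=
      fun t h h' => (cells_nonempty N t).elim fun s hs =>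
        Set.disjoint_left.1 (disjoint_lowerDiamond hK) (Or.inr (h hs)) (h' hs)
    have hA := A.inside
    have hB := B.inside
    have hC := (corridorTiling N K).inside
    refine Prod.ext (DominoTiling.ext (Finset.ext fun t => ?_))
      (DominoTiling.ext (Finset.ext fun t => ?_))
    · simp only [mem_upperPart, mem_glue]
      specialize h1 t; specialize h2 t; specialize hA t; specialize hB t; specialize hC t
      tauto
    · simp only [mem_lowerPart, mem_glue]
      specialize h2 t; specialize h3 t; specialize hA t; specialize hB t; specialize hC t
      tauto
  right_inv S := by
    refine DominoTiling.ext (Finset.ext fun t => ?_)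
    simp only [mem_glue, mem_upperPart, mem_lowerPart]
    constructor
    · rintro ((h | h) | h)
      · exact h.1
      · obtain ⟨k, m, x⟩ := t
        obtain ⟨h1, h2⟩ := mem_corridorTiling.1 h
        have hb := black_mem_corridor.1 (cells_subset_iff.1 h2).1
        obtain rfl : k = _ := h1
        dsimp only at hb
        have := (corridor_forced hK S (-x).toNat (by omega)).2 (by omega) m.toNat (by omega)
        convert this <;> omega
      · exact h.1
    · intro h
      rcases tile_decoupled hK S h with h' | h' | h'
      · exact Or.inl (Or.inl ⟨h, h'⟩)
      · exact Or.inl (Or.inr (mem_corridorTiling.2 h'.symm))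
      · exact Or.inr ⟨h, h'⟩

/-! ### Non-intersecting paths as interlacing configurations -/

section Paths

variable {N K : ℕ} {s : ℤ} {u : Config (2 * N) K}

/-- Disjoint paths keep their initial order: a path that comes down past another
one meets it. -/
theorem IsNonIntersecting.strictMono (hu : IsNonIntersecting s u) (i : Fin (2 * N + 1)) :
    StrictMono (u i) := by
  obtain ⟨i, hi⟩ := i
  induction i with
  | zero =>
    intro j k hjk
    have h0 := hu.endpoints.1
    change u 0 j < u 0 k
    rw [h0, h0]
    exact_mod_cast hjk
  | succ i ih =>
    have ih := ih (by omega)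
    intro j k hjk
    have hlt := ih hjk
    have hd := Set.disjoint_left.1 (hu.disjoint j k hjk.ne)
    rcases Nat.even_or_odd' i with ⟨m, rfl | rfl⟩
    · have hj := hu.odd_step ⟨m, by omega⟩ j
      have hk := hu.odd_step ⟨m, by omega⟩ k
      simp only [oddHeight, evenHeight] at hj hk
      refine lt_of_le_of_ne (by omega) fun h => ?_
      exact hd (a := (2 * m + 1, u ⟨2 * m + 1, hi⟩ j)) (Or.inl ⟨⟨2 * m + 1, hi⟩, rfl⟩)
        (Or.inl ⟨⟨2 * m + 1, hi⟩, by rw [h]⟩)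
    · have hj := hu.even_step ⟨m, by omega⟩ j
      have hk := hu.even_step ⟨m, by omega⟩ k
      simp only [oddHeight, nextHeight] at hj hk
      by_contra hcon
      exact hd (a := (2 * m + 1, u ⟨2 * m + 1, by omega⟩ j)) (Or.inl ⟨⟨2 * m + 1, by omega⟩, rfl⟩)
        (Or.inr ⟨⟨m, by omega⟩, rfl, by
          simp only [nextHeight]
          change u ⟨2 * m + 2, hi⟩ k ≤ _
          change ¬ u ⟨2 * m + 2, hi⟩ j < u ⟨2 * m + 2, hi⟩ k at hcon
          omega, hlt.le⟩)

/-- The heights at which a path descends on level `2m+1` lie below the next path. -/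
theorem IsNonIntersecting.gap (hu : IsNonIntersecting s u) (m : Fin N) {j k : Fin K} (hjk : j < k) :
    oddHeight u m j < nextHeight u m k := by
  have hlt : oddHeight u m j < oddHeight u m k := hu.strictMono _ hjk
  by_contra hcon
  have hd := Set.disjoint_left.1 (hu.disjoint j k hjk.ne)
  exact hd (a := (2 * (m : ℕ) + 1, oddHeight u m j))
    (Or.inl ⟨⟨2 * m + 1, by omega⟩, rfl⟩) (Or.inr ⟨m, rfl, not_lt.1 hcon, hlt.le⟩)

theorem isNonIntersecting_of_interlacing (he : HasEndpoints s u)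
    (hodd : ∀ m j, oddHeight u m j = evenHeight u m j ∨ oddHeight u m j = evenHeight u m j - 1)
    (heven : ∀ m j, nextHeight u m j ≤ oddHeight u m j) (hs : ∀ i, StrictMono (u i))
    (hgap : ∀ m j k, j < k → oddHeight u m j < nextHeight u m k) : IsNonIntersecting s u := by
  refine ⟨he, hodd, heven, ?_⟩
  have key : ∀ j k, j < k → Disjoint (pathVertices u j) (pathVertices u k) := by
    intro j k hjk
    refine Set.disjoint_left.2 ?_
    rintro ⟨i, a⟩ (⟨i', h⟩ | ⟨m, hm, h1, h2⟩) (⟨i'', h'⟩ | ⟨m', hm', h1', h2'⟩)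
    · simp only [Prod.mk.injEq] at h h'
      obtain rfl : i' = i'' := Fin.ext (by omega)
      have := hs i' hjk
      omega
    · simp only [Prod.mk.injEq] at h
      dsimp only at hm' h1'
      have hi : i' = ⟨2 * m' + 1, by omega⟩ := Fin.ext (by dsimp only; omega)
      have h3 := hgap m' j k hjk
      have h4 := h.2
      rw [hi] at h4
      change a = oddHeight u m' j at h4
      omega
    · simp only [Prod.mk.injEq] at h'
      dsimp only at hm h2
      have hi : i'' = ⟨2 * m + 1, by omega⟩ := Fin.ext (by dsimp only; omega)
      have h3 : oddHeight u m j < oddHeight u m k := hs _ hjk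
      have h4 := h'.2
      rw [hi] at h4
      change a = oddHeight u m k at h4
      omega
    · dsimp only at hm hm' h1' h2
      obtain rfl : m = m' := Fin.ext (by omega)
      have h3 := hgap m j k hjk
      omega
  intro j k hjk
  rcases lt_or_gt_of_ne hjk with h | h
  exacts [key j k h, (key k j h).symm]

theorem IsNonIntersecting.antitone (hu : IsNonIntersecting s u) (j : Fin K) :
    Antitone fun i => u i j := by
  refine Fin.antitone_iff_succ_le.2 fun i => ?_
  obtain ⟨i, hi⟩ := i
  rcases Nat.even_or_odd' i with ⟨m, rfl | rfl⟩
  · have h := hu.odd_step ⟨m, by omega⟩ j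
    simp only [oddHeight, evenHeight] at h
    simp only [Fin.succ_mk, Fin.castSucc_mk]
    omega
  · exact hu.even_step ⟨m, by omega⟩ j

theorem IsNonIntersecting.le (hu : IsNonIntersecting s u) (i : Fin (2 * N + 1)) (j : Fin K) :
    u i j ≤ j := by
  have := hu.antitone j (Fin.zero_le i)
  dsimp only at this
  rwa [hu.endpoints.1] at this

theorem IsNonIntersecting.ge (hu : IsNonIntersecting s u) (i : Fin (2 * N + 1)) (j : Fin K) :
    s + j ≤ u i j := by
  have := hu.antitone j (Fin.le_last i)
  dsimp only at this
  rwa [hu.endpoints.2] at this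

theorem evenHeight_zero (hu : HasEndpoints s u) (m : Fin N) (hm : (m : ℕ) = 0) (j : Fin K) :
    evenHeight u m j = j := by
  rw [← hu.1 j, evenHeight]
  congr 1
  simp [hm]

theorem nextHeight_last (hu : HasEndpoints s u) (m : Fin N) (hm : (m : ℕ) + 1 = N) (j : Fin K) :
    nextHeight u m j = s + j := by
  rw [← hu.2 j, nextHeight]
  congr 1
  simp only [Fin.ext_iff, Fin.val_last]
  omega

theorem nextHeight_eq (u : Config (2 * N) K) (m : Fin N) (m' : Fin N) (hm : (m : ℕ) + 1 = m') :
    nextHeight u m = evenHeight u m' := by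
  funext j
  simp only [nextHeight, evenHeight]
  congr 2
  omega

end Paths

/-! ### The tiling around non-intersecting paths -/

/-- The domino `t` belongs to the paths `u`: a West, South or East domino carries an edge of a path,
and a North domino lies at a height that no path visits. -/
def OnPaths {N K : ℕ} (u : Config (2 * N) K) : Tile → Prop
  | (.west, m, x) => ∃ i : Fin N, m = (i : ℤ) ∧
      ∃ j, evenHeight u i j = x + K - N ∧ oddHeight u i j = x + K - N
  | (.south, m, x) => ∃ i : Fin N, m = (i : ℤ) ∧
      ∃ j, evenHeight u i j = x + K - N ∧ oddHeight u i j = x + K - N - 1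
  | (.east, m, x) => ∃ i : Fin N, m = (i : ℤ) + 1 ∧
      ∃ j, nextHeight u i j < x + K - N ∧ x + K - N ≤ oddHeight u i j
  | (.north, m, x) => ∃ i : Fin N, m = (i : ℤ) + 1 ∧ -(K : ℤ) ≤ x ∧ x ≤ N - 1 ∧
      ∀ j, ¬ (nextHeight u i j ≤ x + K - N ∧ x + K - N ≤ oddHeight u i j)

section

variable {N K : ℕ} {u : Config (2 * N) K}

/-- The descents of different paths on level `2m+1` have no common height. -/
theorem IsNonIntersecting.path_unique {s : ℤ} (hu : IsNonIntersecting s u) {m : Fin N} {j k : Fin K}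
    {y : ℤ} (hj : nextHeight u m j ≤ y ∧ y ≤ oddHeight u m j)
    (hk : nextHeight u m k ≤ y ∧ y ≤ oddHeight u m k) : j = k := by
  by_contra h
  rcases lt_or_gt_of_ne h with h | h
  · have := hu.gap m h
    omega
  · have := hu.gap m h
    omega

/-- The endpoints fill the heights below those of the Aztec diamond. -/
theorem exists_eq_nextHeight_last (hu : HasEndpoints (-(N : ℤ)) u) {m : Fin N}
    (hm : (m : ℕ) + 1 = N) {y : ℤ} (h1 : -(N : ℤ) ≤ y) (h2 : y < K - N) :
    ∃ j, nextHeight u m j = y :=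
  ⟨⟨(y + N).toNat, by omega⟩, by rw [nextHeight_last hu m hm]; dsimp only; omega⟩

/-- The heights decrease from `j` to `j - N` along a path, so its dominoes stay in a rectangle that
contains the extended domain. They avoid the colored squares missing from its first and last
columns: all paths start at non-negative heights, and the heights below `K - N` in the last column
are endpoints. -/
theorem onPaths_cells (hK : N ≤ K) (hu : IsNonIntersecting (-(N : ℤ)) u) (t : Tile)
    (ht : OnPaths u t) : Tile.cells N t ⊆ extendedDomain N K := by
  rw [cells_subset_iff, black_mem_extendedDomain hK, white_mem_extendedDomain hK]
  have hle : ∀ i j, u i j ≤ K - 1 := fun i j => by have := hu.le i j; omega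
  have hge : ∀ i j, -(N : ℤ) ≤ u i j := fun i j => by have := hu.ge i j; omega
  obtain ⟨k, m, x⟩ := t
  cases k
  · obtain ⟨i, rfl, h1, h2, h3⟩ := ht
    have key : (i : ℤ) + 1 = N → 0 ≤ x := by
      intro hi
      by_contra hx
      obtain ⟨j, hj⟩ := exists_eq_nextHeight_last hu.endpoints (m := i) (y := x + K - N) (by omega)
        (by omega) (by omega)
      exact h3 j ⟨hj.le, hj ▸ hu.even_step i j⟩
    simp only [Tile.white]
    omega
  · obtain ⟨i, rfl, j, h1, h2⟩ := ht
    have l1 : evenHeight u i j ≤ K - 1 := hle _ _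
    have l2 : -(N : ℤ) ≤ evenHeight u i j := hge _ _
    have l3 := evenHeight_zero hu.endpoints i
    simp only [Tile.white]
    refine ⟨⟨by omega, by omega, by omega, by omega, fun h => ?_, by omega⟩, by omega, by omega,
      by omega, by omega⟩
    have := l3 (by omega) j
    omega
  · obtain ⟨i, rfl, j, h1, h2⟩ := ht
    have l1 : evenHeight u i j ≤ K - 1 := hle _ _
    have l2 : -(N : ℤ) ≤ oddHeight u i j := hge _ _
    have l3 := evenHeight_zero hu.endpoints i
    simp only [Tile.white]
    refine ⟨⟨by omega, by omega, by omega, by omega, fun h => ?_, by omega⟩, by omega, by omega,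
      by omega, by omega⟩
    have := l3 (by omega) j
    omega
  · obtain ⟨i, rfl, j, h1, h2⟩ := ht
    have l1 : oddHeight u i j ≤ K - 1 := hle _ _
    have l2 : -(N : ℤ) ≤ nextHeight u i j := hge _ _
    have key : (i : ℤ) + 1 = N → 0 ≤ x := by
      intro hi
      by_contra hx
      obtain ⟨k, hk⟩ := exists_eq_nextHeight_last hu.endpoints (m := i) (y := x + K - N) (by omega)
        (by omega) (by omega)
      obtain rfl := hu.path_unique (m := i) (y := x + K - N) ⟨h1.le, h2⟩
        ⟨hk.le, hk ▸ hu.even_step i k⟩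
      omega
    simp only [Tile.white]
    omega

/-- A colored square at a height that a path visits at level `2m` is covered by a West or South
domino of this path. Any other one is covered by an East domino if a path descends across its height
from level `2m-1`, and by a North domino if none does. -/
theorem onPaths_black (hK : N ≤ K) (hu : IsNonIntersecting (-(N : ℤ)) u) (m x : ℤ)
    (h : blackSquare N m x ∈ extendedDomain N K) : ∃! t : Tile, OnPaths u t ∧ t.2 = (m, x) := by
  rw [black_mem_extendedDomain hK] at h
  obtain ⟨y, hy⟩ : ∃ y, y = x + K - N := ⟨_, rfl⟩
  -- A square visited by a path at level `2m` is covered by a West or South domino only.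
  have hpart : ∀ (i : Fin N) (j : Fin K), m = i → evenHeight u i j = y →
      ∃! t : Tile, OnPaths u t ∧ t.2 = (m, x) := by
    rintro i j rfl hj
    have hne : ∀ t, OnPaths u t → t.2 = ((i : ℤ), x) → t.1 ≠ .east ∧ t.1 ≠ .north := by
      rintro ⟨k, q⟩ ht rfl
      have haux : ∀ i' : Fin N, (i : ℤ) = (i' : ℤ) + 1 → nextHeight u i' j = y := by
        intro i' h
        rw [nextHeight_eq u i' i (by omega), hj]
      refine ⟨?_, ?_⟩
      · rintro rfl
        obtain ⟨i', h1, k, h2, h3⟩ := ht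
        have h4 := haux i' h1
        obtain rfl := hu.path_unique (m := i') (j := k) (k := j) (y := y) ⟨by omega, by omega⟩
          ⟨h4.le, h4 ▸ hu.even_step i' j⟩
        omega
      · rintro rfl
        obtain ⟨i', h1, -, -, h3⟩ := ht
        have h4 := haux i' h1
        exact h3 j ⟨by omega, by have := hu.even_step i' j; omega⟩
    have hinj : ∀ k, evenHeight u i k = y → k = j := fun k hk =>
      (hu.strictMono ⟨2 * i, by omega⟩).injective (hk.trans hj.symm)
    rcases hu.odd_step i j with hs | hs
    · refine ⟨(.west, i, x), ⟨⟨i, rfl, j, by omega, by omega⟩, rfl⟩, ?_⟩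
      rintro ⟨k, q⟩ ⟨ht, rfl⟩
      have := hne _ ht rfl
      cases k
      · exact absurd rfl this.2
      · rfl
      · obtain ⟨i', h1, k, h2, h3⟩ := ht
        obtain rfl : i = i' := Fin.ext (by omega)
        obtain rfl := hinj k (by omega)
        omega
      · exact absurd rfl this.1
    · refine ⟨(.south, i, x), ⟨⟨i, rfl, j, by omega, by omega⟩, rfl⟩, ?_⟩
      rintro ⟨k, q⟩ ⟨ht, rfl⟩
      have := hne _ ht rfl
      cases k
      · exact absurd rfl this.2
      · obtain ⟨i', h1, k, h2, h3⟩ := ht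
        obtain rfl : i = i' := Fin.ext (by omega)
        obtain rfl := hinj k (by omega)
        omega
      · rfl
      · exact absurd rfl this.1
  by_cases hp : ∃ (i : Fin N) (j : Fin K), m = i ∧ evenHeight u i j = y
  · obtain ⟨i, j, h1, h2⟩ := hp
    exact hpart i j h1 h2
  · have hm0 : m ≠ 0 := by
      rintro rfl
      refine hp ⟨⟨0, by omega⟩, ⟨y.toNat, by omega⟩, rfl, ?_⟩
      rw [evenHeight_zero hu.endpoints _ rfl]
      dsimp only
      omega
    obtain ⟨i, hi⟩ : ∃ i : Fin N, m = (i : ℤ) + 1 :=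
      ⟨⟨(m - 1).toNat, by omega⟩, by dsimp only; omega⟩
    have hnext : ∀ j, nextHeight u i j ≠ y := by
      intro j hj
      by_cases hN : (i : ℕ) + 1 < N
      · exact hp ⟨⟨i + 1, hN⟩, j, by simpa using hi, by
          rw [← nextHeight_eq u i ⟨i + 1, hN⟩ rfl, hj]⟩
      · rw [nextHeight_last hu.endpoints i (by omega)] at hj
        omega
    have hws : ∀ t, OnPaths u t → t.2 = (m, x) → t.1 ≠ .west ∧ t.1 ≠ .south := by
      rintro ⟨k, q⟩ ht rfl
      refine ⟨?_, ?_⟩ <;> rintro rfl <;> obtain ⟨i', h1, k, h2, h3⟩ := ht <;>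
        exact hp ⟨i', k, h1, by omega⟩
    by_cases hE : ∃ j, nextHeight u i j < y ∧ y ≤ oddHeight u i j
    · obtain ⟨j, hj⟩ := hE
      refine ⟨(.east, m, x), ⟨⟨i, hi, j, by omega, by omega⟩, rfl⟩, ?_⟩
      rintro ⟨k, q⟩ ⟨ht, rfl⟩
      have := hws _ ht rfl
      cases k
      · obtain ⟨i', h1, -, -, h3⟩ := ht
        obtain rfl : i = i' := Fin.ext (by omega)
        exact absurd ⟨by omega, by omega⟩ (h3 j)
      · exact absurd rfl this.1
      · exact absurd rfl this.2
      · rfl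
    · refine ⟨(.north, m, x), ⟨⟨i, hi, by omega, by omega, fun j hj => ?_⟩, rfl⟩, ?_⟩
      · have := hnext j
        exact hE ⟨j, by omega⟩
      rintro ⟨k, q⟩ ⟨ht, rfl⟩
      have := hws _ ht rfl
      cases k
      · rfl
      · exact absurd rfl this.1
      · exact absurd rfl this.2
      · obtain ⟨i', h1, j, h2, h3⟩ := ht
        obtain rfl : i = i' := Fin.ext (by omega)
        exact absurd ⟨j, by omega⟩ hE

/-- An uncolored square at a height that a path visits at level `2m+1` is the end of a West or South
domino of this path, at the lower heights of the descent of a path it is the end of an East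
domino, and elsewhere that of a North domino. -/
theorem onPaths_white (hK : N ≤ K) (hu : IsNonIntersecting (-(N : ℤ)) u) (m x : ℤ)
    (h : whiteSquare N m x ∈ extendedDomain N K) :
    ∃! t : Tile, OnPaths u t ∧ Tile.white t = (m, x) := by
  rw [white_mem_extendedDomain hK] at h
  obtain ⟨y, hy⟩ : ∃ y, y = x + K - N := ⟨_, rfl⟩
  obtain ⟨i, rfl⟩ : ∃ i : Fin N, m = i := ⟨⟨m.toNat, by omega⟩, by dsimp only; omega⟩
  have hinj : ∀ j k, oddHeight u i j = oddHeight u i k → j = k := fun j k h =>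
    (hu.strictMono ⟨2 * i + 1, by omega⟩).injective h
  have hstep := hu.even_step i
  have hodd := hu.odd_step i
  -- What a domino covering the square says about the paths.
  have hcov : ∀ k m' x', OnPaths u (k, m', x') → Tile.white (k, m', x') = ((i : ℤ), x) →
      (k = .west ∧ m' = i ∧ x' = x ∧ ∃ j, evenHeight u i j = y ∧ oddHeight u i j = y) ∨
      (k = .south ∧ m' = i ∧ x' = x + 1 ∧ ∃ j, evenHeight u i j = y + 1 ∧ oddHeight u i j = y) ∨
      (k = .east ∧ m' = i + 1 ∧ x' = x + 1 ∧ ∃ j, nextHeight u i j ≤ y ∧ y < oddHeight u i j) ∨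
      (k = .north ∧ m' = i + 1 ∧ x' = x ∧
        ∀ j, ¬ (nextHeight u i j ≤ y ∧ y ≤ oddHeight u i j)) := by
    intro k m' x' ht hw
    cases k <;> simp only [Tile.white, Prod.mk.injEq] at hw
    · obtain ⟨i', h1, -, -, h3⟩ := ht
      obtain rfl : i = i' := Fin.ext (by omega)
      refine Or.inr (Or.inr (Or.inr ⟨rfl, h1, hw.2, fun j hj => h3 j ?_⟩))
      omega
    · obtain ⟨i', h1, j, h2, h3⟩ := ht
      obtain rfl : i = i' := Fin.ext (by omega)
      exact Or.inl ⟨rfl, h1, hw.2, j, by omega, by omega⟩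
    · obtain ⟨i', h1, j, h2, h3⟩ := ht
      obtain rfl : i = i' := Fin.ext (by omega)
      exact Or.inr (Or.inl ⟨rfl, h1, by omega, j, by omega, by omega⟩)
    · obtain ⟨i', h1, j, h2, h3⟩ := ht
      obtain rfl : i = i' := Fin.ext (by omega)
      exact Or.inr (Or.inr (Or.inl ⟨rfl, h1, by omega, j, by omega, by omega⟩))
  by_cases hp : ∃ j, nextHeight u i j ≤ y ∧ y ≤ oddHeight u i j
  · obtain ⟨j, hj⟩ := hp
    have huniq : ∀ k, nextHeight u i k ≤ y → y ≤ oddHeight u i k → k = j :=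
      fun k h1 h2 => hu.path_unique ⟨h1, h2⟩ hj
    by_cases hyo : oddHeight u i j = y
    · rcases hodd j with hs | hs
      · refine ⟨(.west, i, x), ⟨⟨i, rfl, j, by omega, by omega⟩, rfl⟩, ?_⟩
        rintro ⟨k, m', x'⟩ ⟨ht, hw⟩
        rcases hcov k m' x' ht hw with ⟨rfl, rfl, rfl, -⟩ | ⟨-, -, -, j', h1, h2⟩ |
          ⟨-, -, -, j', h1, h2⟩ | ⟨-, -, -, h1⟩
        · rfl
        · obtain rfl := hinj j' j (by omega)
          omega
        · obtain rfl := huniq j' h1 h2.le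
          omega
        · exact absurd hj (h1 j)
      · refine ⟨(.south, i, x + 1), ⟨⟨i, rfl, j, by omega, by omega⟩, by simp [Tile.white]⟩, ?_⟩
        rintro ⟨k, m', x'⟩ ⟨ht, hw⟩
        rcases hcov k m' x' ht hw with ⟨-, -, -, j', h1, h2⟩ | ⟨rfl, rfl, rfl, -⟩ |
          ⟨-, -, -, j', h1, h2⟩ | ⟨-, -, -, h1⟩
        · obtain rfl := hinj j' j (by omega)
          omega
        · rfl
        · obtain rfl := huniq j' h1 h2.le
          omega
        · exact absurd hj (h1 j)
    · refine ⟨(.east, i + 1, x + 1), ⟨⟨i, rfl, j, by omega, by omega⟩, by simp [Tile.white]⟩, ?_⟩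
      rintro ⟨k, m', x'⟩ ⟨ht, hw⟩
      rcases hcov k m' x' ht hw with ⟨-, -, -, j', h1, h2⟩ | ⟨-, -, -, j', h1, h2⟩ |
        ⟨rfl, rfl, rfl, -⟩ | ⟨-, -, -, h1⟩
      · obtain rfl := huniq j' (h2 ▸ hstep j') h2.ge
        omega
      · obtain rfl := huniq j' (h2 ▸ hstep j') h2.ge
        omega
      · rfl
      · exact absurd hj (h1 j)
  · push Not at hp
    refine ⟨(.north, i + 1, x), ⟨⟨i, rfl, by omega, by omega, fun j hj => ?_⟩,
      by simp [Tile.white]⟩, ?_⟩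
    · have := hp j
      omega
    rintro ⟨k, m', x'⟩ ⟨ht, hw⟩
    rcases hcov k m' x' ht hw with ⟨-, -, -, j', h1, h2⟩ | ⟨-, -, -, j', h1, h2⟩ |
      ⟨-, -, -, j', h1, h2⟩ | ⟨rfl, rfl, rfl, h1⟩
    · have := hp j' (h2 ▸ hstep j')
      omega
    · have := hp j' (h2 ▸ hstep j')
      omega
    · have := hp j' h1
      omega
    · rfl

/-- Non-intersecting paths are drawn on a tiling of the extended domain. -/
theorem exists_isDrawing_of_paths (hK : N ≤ K) (hu : IsNonIntersecting (-(N : ℤ)) u) :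
    ∃ S : DominoTiling N (extendedDomain N K), IsDrawing S u := by
  refine ⟨.ofPred (finite_extendedDomain N K) (OnPaths u) (onPaths_cells hK hu)
    (existsUnique_cover (onPaths_black hK hu) (onPaths_white hK hu)), ?_, ?_, ?_⟩ <;>
  · intro m x
    rw [DominoTiling.mem_ofPred]
    constructor
    · rintro ⟨i, h1, j, h2⟩
      obtain rfl : m = i := Fin.ext (by omega)
      exact ⟨j, h2⟩
    · exact fun h => ⟨m, rfl, h⟩

end

/-! ### The paths on a tiling -/

section Counting

/-- The enumeration of a finite set in increasing order, in terms of the counting function of the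
set. -/
theorem lt_iff_lt_card {K : ℕ} {Q : Finset ℤ} {q : Fin K → ℤ} (hq : StrictMono q)
    (hr : Set.range q = Q) (j : Fin K) (y : ℤ) :
    q j < y ↔ (j : ℕ) < (Q.filter (· < y)).card := by
  classical
  have himage : Q.filter (· < y) = (Finset.univ.filter fun j => q j < y).image q := by
    ext z
    have hz : z ∈ Q ↔ z ∈ Set.range q := by rw [hr]; rfl
    simp only [Finset.mem_filter, hz, Set.mem_range, Finset.mem_image, Finset.mem_univ, true_and]
    constructor
    · rintro ⟨⟨k, rfl⟩, h⟩
      exact ⟨k, h, rfl⟩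
    · rintro ⟨k, h, rfl⟩
      exact ⟨⟨k, rfl⟩, h⟩
  rw [himage, Finset.card_image_of_injective _ hq.injective]
  constructor
  · intro h
    have : Finset.Iic j ⊆ Finset.univ.filter fun j => q j < y := fun k hk => by
      simpa using (hq.monotone (Finset.mem_Iic.1 hk)).trans_lt h
    have := Finset.card_le_card this
    rw [Fin.card_Iic] at this
    omega
  · intro h
    by_contra hcon
    have : (Finset.univ.filter fun j => q j < y) ⊆ Finset.Iio j := fun k hk => by
      rw [Finset.mem_Iio]
      by_contra hk'
      have h1 := hq.monotone (not_lt.1 hk')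
      have h2 := (Finset.mem_filter.1 hk).2
      omega
    have := Finset.card_le_card this
    rw [Fin.card_Iio] at this
    omega

theorem card_filter_lt_succ (Q : Finset ℤ) (y : ℤ) [Decidable (y ∈ Q)] :
    (Q.filter (· < y + 1)).card = (Q.filter (· < y)).card + if y ∈ Q then 1 else 0 := by
  classical
  split_ifs with h
  · rw [← Finset.card_insert_of_notMem (a := y) (s := Q.filter (· < y)) (by simp)]
    congr 1
    ext z
    simp only [Finset.mem_filter, Finset.mem_insert]
    constructor
    · rintro ⟨h1, h2⟩
      by_cases hz : z = y
      · exact Or.inl hz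
      · exact Or.inr ⟨h1, by omega⟩
    · rintro (rfl | ⟨h1, h2⟩)
      · exact ⟨h, by omega⟩
      · exact ⟨h1, by omega⟩
  · congr 1
    ext z
    simp only [Finset.mem_filter]
    refine and_congr_right fun hz => ⟨fun h' => ?_, fun h' => by omega⟩
    have : z ≠ y := fun e => h (e ▸ hz)
    omega

/-- Two finite sets interlace if their counting functions differ by the indicator function of a
set `A`; then `A` consists of the gaps between the corresponding points. -/
theorem interlacing_of_card {K : ℕ} {O Q : Finset ℤ} {o q : Fin K → ℤ} (ho : StrictMono o)
    (hro : Set.range o = O) (hq : StrictMono q) (hrq : Set.range q = Q) (A : ℤ → Prop)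
    [DecidablePred A]
    (hcard : ∀ y, (Q.filter (· < y)).card = (O.filter (· < y)).card + if A y then 1 else 0)
    (hA : ∀ y ∈ Q, ¬ A y) :
    (∀ j, q j ≤ o j) ∧ (∀ j k, j < k → o j < q k) ∧ ∀ y, A y ↔ ∃ j, q j < y ∧ y ≤ o j := by
  have cq := lt_iff_lt_card hq hrq
  have co := lt_iff_lt_card ho hro
  refine ⟨fun j => ?_, fun j k hjk => ?_, fun y => ⟨fun h => ?_, ?_⟩⟩
  · have h1 := (co j (o j + 1)).1 (by omega)
    have h2 := (cq j (o j + 1)).2 (by rw [hcard]; omega)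
    omega
  · have h1 := (cq k (q k + 1)).1 (by omega)
    have h2 := hA (q k) (by rw [← Finset.mem_coe, ← hrq]; exact ⟨k, rfl⟩)
    have h3 := hcard (q k)
    rw [if_neg h2, add_zero] at h3
    rw [co, ← h3]
    rw [← cq]
    exact hq hjk
  · have h1 := hcard y
    rw [if_pos h] at h1
    have hK : (Q.filter (· < y)).card ≤ K := by
      have h2 : Q.card = K := by
        rw [← Set.ncard_coe_finset, ← hrq, ← Set.image_univ,
          Set.ncard_image_of_injective _ hq.injective, Set.ncard_univ, Nat.card_fin]
      exact h2 ▸ Finset.card_filter_le _ _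
    refine ⟨⟨(O.filter (· < y)).card, by omega⟩, (cq _ _).2 (by dsimp only; omega), ?_⟩
    by_contra h2
    have := (co ⟨(O.filter (· < y)).card, by omega⟩ y).1 (by omega)
    simp at this
  · rintro ⟨j, h1, h2⟩
    by_contra h
    have h3 := hcard y
    rw [if_neg h, add_zero] at h3
    have h4 := (cq j y).1 h1
    have h5 := (co j y).2 (by omega)
    omega

end Counting

section Levels

variable {N K : ℕ}

/-- The heights at which the paths on a tiling reach level `2m`. At the last level no West or South
dominoes show them, and they are the prescribed endpoints. -/
noncomputable def evenLevel (S : DominoTiling N (extendedDomain N K)) (m : ℕ) : Finset ℤ :=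
  if m = N then Finset.Icc (-(N : ℤ)) (K - N - 1) else
    (Finset.Icc (-(N : ℤ)) (K - 1)).filter fun y =>
      (TileKind.west, (m : ℤ), y - K + N) ∈ S.tiles ∨ (TileKind.south, (m : ℤ), y - K + N) ∈ S.tiles

/-- The heights at which the paths on a tiling reach level `2m+1`. -/
noncomputable def oddLevel (S : DominoTiling N (extendedDomain N K)) (m : ℕ) : Finset ℤ :=
  (Finset.Icc (-(N : ℤ)) (K - 1)).filter fun y =>
    (TileKind.west, (m : ℤ), y - K + N) ∈ S.tiles ∨
      (TileKind.south, (m : ℤ), y + 1 - K + N) ∈ S.tiles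

/-- The step of the paths on a tiling from the height `y` at level `2m`: along a South domino if
there is one at this height, and otherwise along a West domino. -/
noncomputable def oddStep (S : DominoTiling N (extendedDomain N K)) (m : ℕ) (y : ℤ) : ℤ :=
  if (TileKind.south, (m : ℤ), y - K + N) ∈ S.tiles then y - 1 else y

variable (hK : N ≤ K) (S : DominoTiling N (extendedDomain N K))
include hK

theorem mem_evenLevel {m : ℕ} (hm : m < N) {y : ℤ} :
    y ∈ evenLevel S m ↔ (TileKind.west, (m : ℤ), y - K + N) ∈ S.tiles ∨
      (TileKind.south, (m : ℤ), y - K + N) ∈ S.tiles := by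
  rw [evenLevel, if_neg hm.ne, Finset.mem_filter, and_iff_right_iff_imp]
  rintro (h | h) <;>
  · have := black_bounds hK S h
    dsimp only at this
    rw [Finset.mem_Icc]
    omega

theorem mem_oddLevel {m : ℕ} {y : ℤ} :
    y ∈ oddLevel S m ↔ (TileKind.west, (m : ℤ), y - K + N) ∈ S.tiles ∨
      (TileKind.south, (m : ℤ), y + 1 - K + N) ∈ S.tiles := by
  rw [oddLevel, Finset.mem_filter, and_iff_right_iff_imp]
  rintro (h | h) <;>
  · have := white_bounds hK S h
    simp only [Tile.white] at this
    rw [Finset.mem_Icc]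
    omega

/-- After the first level, the squares without a point are those of the North and East dominoes. -/
theorem mem_evenLevel_succ {m : ℕ} (hm : m < N) {y : ℤ} :
    y ∈ evenLevel S (m + 1) ↔ (-(N : ℤ) ≤ y ∧ y ≤ K - 1) ∧
      (TileKind.north, (m : ℤ) + 1, y - K + N) ∉ S.tiles ∧
      (TileKind.east, (m : ℤ) + 1, y - K + N) ∉ S.tiles := by
  rcases Nat.lt_or_ge (m + 1) N with h | h
  · rw [mem_evenLevel hK S h]
    push_cast
    constructor
    · intro h'
      refine ⟨?_, fun h1 => ?_, fun h1 => ?_⟩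
      · rcases h' with h' | h' <;>
        · have := black_bounds hK S h'
          dsimp only at this
          omega
      · rcases h' with h' | h' <;> simpa using S.eq_of_black h' h1 rfl
      · rcases h' with h' | h' <;> simpa using S.eq_of_black h' h1 rfl
    · rintro ⟨h1, h2, h3⟩
      have := S.exists_kind (m := (m : ℤ) + 1) (x := y - K + N)
        ((black_mem_extendedDomain hK).2 (by omega))
      tauto
  · obtain rfl : N = m + 1 := by omega
    rw [evenLevel, if_pos rfl, Finset.mem_Icc]
    constructor
    · intro h'
      refine ⟨by omega, fun h1 => ?_, fun h1 => ?_⟩ <;>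
      · have := black_bounds hK S h1
        dsimp only at this
        omega
    · rintro ⟨h1, h2, h3⟩
      by_contra h4
      rcases S.exists_kind (m := (m : ℤ) + 1) (x := y - K + (m + 1 : ℕ))
        ((black_mem_extendedDomain hK).2 (by omega)) with h | h | h | h
      · exact h2 h
      · have := white_bounds hK S h
        simp only [Tile.white] at this
        omega
      · have := white_bounds hK S h
        simp only [Tile.white] at this
        omega
      · exact h3 h

theorem mem_evenLevel_zero (hN : 1 ≤ N) {y : ℤ} : y ∈ evenLevel S 0 ↔ 0 ≤ y ∧ y ≤ K - 1 := by
  rw [mem_evenLevel hK S (by omega)]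
  constructor
  · rintro (h | h) <;>
    · have := black_bounds hK S h
      dsimp only at this
      omega
  · intro h
    rcases S.exists_kind (m := ((0 : ℕ) : ℤ)) (x := y - K + N)
      ((black_mem_extendedDomain hK).2 (by omega)) with h' | h' | h' | h'
    · have := white_bounds hK S h'
      simp only [Tile.white] at this
      omega
    · exact Or.inl h'
    · exact Or.inr h'
    · have := white_bounds hK S h'
      simp only [Tile.white] at this
      omega

/-- Each of the `N + K` colored squares between two successive levels, and each of the uncolored
ones next to them, is covered exactly once. So along a column the numbers of points of the two
levels below a given height differ by one at the East dominoes, and agree elsewhere. -/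
theorem card_evenLevel_succ {m : ℕ} (hm : m < N) (y : ℤ) :
    ((evenLevel S (m + 1)).filter (· < y)).card = ((oddLevel S m).filter (· < y)).card +
      if (TileKind.east, (m : ℤ) + 1, y - K + N) ∈ S.tiles then 1 else 0 := by
  have heast : ∀ y : ℤ, (TileKind.east, (m : ℤ) + 1, y - K + N) ∈ S.tiles →
      -(N : ℤ) < y ∧ y ≤ K - 1 := by
    intro y h
    have h1 := black_bounds hK S h
    have h2 := white_bounds hK S h
    simp only [Tile.white] at h1 h2
    omega
  have hodd : ∀ y, y ∈ oddLevel S m → -(N : ℤ) ≤ y ∧ y ≤ K - 1 := fun y h =>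
    Finset.mem_Icc.1 (Finset.mem_filter.1 h).1
  have heven : ∀ y, y ∈ evenLevel S (m + 1) → -(N : ℤ) ≤ y ∧ y ≤ K - 1 := fun y h =>
    ((mem_evenLevel_succ hK S hm).1 h).1
  have hlow : ∀ y : ℤ, y ≤ -N →
      ((evenLevel S (m + 1)).filter (· < y)).card = ((oddLevel S m).filter (· < y)).card +
      if (TileKind.east, (m : ℤ) + 1, y - K + N) ∈ S.tiles then 1 else 0 := by
    intro y hy
    have h1 : (evenLevel S (m + 1)).filter (· < y) = ∅ := Finset.filter_false_of_mem fun z hz => by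
      have := heven z hz
      omega
    have h2 : (oddLevel S m).filter (· < y) = ∅ := Finset.filter_false_of_mem fun z hz => by
      have := hodd z hz
      omega
    rw [if_neg fun h => by have := heast y h; omega, h1, h2]
    rfl
  rcases le_or_gt y (-N) with hy | hy
  · exact hlow y hy
  induction y, hy.le using Int.leInduction with
  | base => exact hlow _ le_rfl
  | succ y hy' ih =>
    have ih := (le_or_gt y (-N)).elim (hlow y) ih
    rw [card_filter_lt_succ, card_filter_lt_succ, ih]
    rcases le_or_gt y (K - 1) with hyK | hyK
    · have hb := mem_evenLevel_succ hK S hm (y := y)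
      have ho := mem_oddLevel hK S (m := m) (y := y)
      have hw := S.exists_white (m := m) (x := y - K + N)
        ((white_mem_extendedDomain hK).2 (by omega))
      have e1 : y - K + N + 1 = y + 1 - (K : ℤ) + N := by ring
      rw [e1] at hw
      have x1 : ¬((TileKind.north, (m : ℤ) + 1, y - K + N) ∈ S.tiles ∧
          (TileKind.east, (m : ℤ) + 1, y - K + N) ∈ S.tiles) := fun h => by
        simpa using S.eq_of_black h.1 h.2 rfl
      have x2 : ∀ k k' m' x' m'' x'', k ≠ k' → Tile.white (k, m', x') = Tile.white (k', m'', x'') →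
          ¬((k, m', x') ∈ S.tiles ∧ (k', m'', x'') ∈ S.tiles) := fun k k' m' x' m'' x'' hne hw h =>
        hne (congrArg Prod.fst (S.eq_of_white h.1 h.2 hw))
      have y1 := x2 .north .west (m + 1) (y - K + N) m (y - K + N) (by simp) (by simp [Tile.white])
      have y2 := x2 .north .south (m + 1) (y - K + N) m (y + 1 - K + N) (by simp)
        (by ext <;> simp only [Tile.white] <;> ring)
      have y3 := x2 .north .east (m + 1) (y - K + N) (m + 1) (y + 1 - K + N) (by simp)
        (by ext <;> simp only [Tile.white]; ring)
      have y4 := x2 .west .east m (y - K + N) (m + 1) (y + 1 - K + N) (by simp)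
        (by ext <;> simp only [Tile.white] <;> ring)
      have y5 := x2 .south .east m (y + 1 - K + N) (m + 1) (y + 1 - K + N) (by simp)
        (by ext <;> simp only [Tile.white]; ring)
      by_cases hn : (TileKind.north, (m : ℤ) + 1, y - K + N) ∈ S.tiles
      · rw [if_neg fun h => x1 ⟨hn, h⟩, if_neg fun h => (hb.1 h).2.1 hn,
          if_neg fun h => (ho.1 h).elim (fun h => y1 ⟨hn, h⟩) fun h => y2 ⟨hn, h⟩,
          if_neg fun h => y3 ⟨hn, h⟩]
      · have z1 : y ∈ evenLevel S (m + 1) ↔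
            (TileKind.east, (m : ℤ) + 1, y - K + N) ∉ S.tiles := by
          rw [hb]
          exact ⟨fun h => h.2.2, fun h => ⟨⟨by omega, hyK⟩, hn, h⟩⟩
        have z2 : y ∈ oddLevel S m ↔
            (TileKind.east, (m : ℤ) + 1, y + 1 - K + N) ∉ S.tiles := by
          rw [ho]
          refine ⟨fun h h' => h.elim (fun h => y4 ⟨h, h'⟩) fun h => y5 ⟨h, h'⟩, fun h => ?_⟩
          rcases hw with h' | h' | h' | h'
          exacts [absurd h' hn, Or.inl h', Or.inr h', absurd h' h]
        simp only [z1, z2]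
        split_ifs <;> omega
    · rw [if_neg fun h => by have := heast _ h; omega, if_neg fun h => by have := heven _ h; omega,
        if_neg fun h => by have := hodd _ h; omega, if_neg fun h => by have := heast _ h; omega]

theorem card_evenLevel_succ_eq {m : ℕ} (hm : m < N) :
    (evenLevel S (m + 1)).card = (oddLevel S m).card := by
  classical
  have h := card_evenLevel_succ hK S hm K
  have hE : (TileKind.east, (m : ℤ) + 1, (K : ℤ) - K + N) ∉ S.tiles := fun h' => by
    have := black_bounds hK S h'
    dsimp only at this
    omega
  have h1 : (evenLevel S (m + 1)).filter (· < (K : ℤ)) = evenLevel S (m + 1) :=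
    Finset.filter_true_of_mem fun y hy => by
      have := ((mem_evenLevel_succ hK S hm).1 hy).1
      omega
  have h2 : (oddLevel S m).filter (· < (K : ℤ)) = oddLevel S m :=
    Finset.filter_true_of_mem fun y hy => by
      have := Finset.mem_Icc.1 (Finset.mem_filter.1 hy).1
      omega
  rwa [if_neg hE, h1, h2] at h

/-- A West and a South domino at consecutive heights would overlap. -/
theorem strictMonoOn_oddStep {m : ℕ} (hm : m < N) :
    StrictMonoOn (oddStep S m) (evenLevel S m) := by
  intro y hy z hz hyz
  simp only [Finset.mem_coe, mem_evenLevel hK S hm] at hy hz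
  have hne : ¬((TileKind.west, (m : ℤ), y - K + N) ∈ S.tiles ∧
      (TileKind.south, (m : ℤ), z - K + N) ∈ S.tiles ∧ z = y + 1) := by
    rintro ⟨h1, h2, rfl⟩
    have := S.eq_of_white h1 h2 (by ext <;> simp only [Tile.white]; ring)
    simp at this
  simp only [oddStep]
  split_ifs with h1 h2 h2
  · omega
  · omega
  · have : z ≠ y + 1 := fun h => hne ⟨by tauto, h2, h⟩
    omega
  · omega

theorem image_oddStep {m : ℕ} (hm : m < N) :
    oddStep S m '' evenLevel S m = oddLevel S m := by
  ext z
  simp only [Set.mem_image, Finset.mem_coe, mem_evenLevel hK S hm, mem_oddLevel hK S, oddStep]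
  constructor
  · rintro ⟨y, hy, rfl⟩
    split_ifs with h
    · rw [sub_add_cancel]
      exact Or.inr h
    · tauto
  · rintro (h | h)
    · refine ⟨z, Or.inl h, if_neg fun h' => ?_⟩
      simpa using S.eq_of_black h h' rfl
    · exact ⟨z + 1, Or.inr h, by rw [if_pos h]; ring⟩

theorem card_oddLevel_eq {m : ℕ} (hm : m < N) : (oddLevel S m).card = (evenLevel S m).card := by
  classical
  rw [← Finset.card_image_of_injOn (strictMonoOn_oddStep hK S hm).injOn]
  congr 1
  rw [← Finset.coe_inj, Finset.coe_image, image_oddStep hK S hm]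

theorem card_evenLevel (hN : 1 ≤ N) {m : ℕ} (hm : m ≤ N) : (evenLevel S m).card = K := by
  induction m with
  | zero =>
    have : evenLevel S 0 = Finset.Icc (0 : ℤ) (K - 1) := by
      ext y
      rw [mem_evenLevel_zero hK S hN, Finset.mem_Icc]
    rw [this, Int.card_Icc]
    omega
  | succ m ih => rw [card_evenLevel_succ_eq hK S hm, card_oddLevel_eq hK S hm, ih (by omega)]

/-- The sorted points of each level. -/
theorem exists_levels (hN : 1 ≤ N) : ∃ u : Config (2 * N) K,
    (∀ i, StrictMono (u i)) ∧ (∀ m (hm : m ≤ N), Set.range (u ⟨2 * m, by omega⟩) = evenLevel S m) ∧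
      ∀ m (hm : m < N), Set.range (u ⟨2 * m + 1, by omega⟩) = oddLevel S m := by
  have hcard : ∀ i : Fin (2 * N + 1),
      (if Even (i : ℕ) then evenLevel S (i / 2) else oddLevel S (i / 2)).card = K := by
    intro i
    split_ifs with h
    · exact card_evenLevel hK S hN (by omega)
    · have : (i : ℕ) / 2 < N := by
        have := Nat.not_even_iff_odd.1 h
        obtain ⟨k, hk⟩ := this
        omega
      rw [card_oddLevel_eq hK S this, card_evenLevel hK S hN this.le]
  refine ⟨fun i => Finset.orderEmbOfFin _ (hcard i), fun i => OrderEmbedding.strictMono _,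
    fun m hm => ?_, fun m hm => ?_⟩
  · rw [Finset.range_orderEmbOfFin]
    simp
  · rw [Finset.range_orderEmbOfFin]
    have h1 : ¬ Even (2 * m + 1) := by simp
    have h2 : (2 * m + 1) / 2 = m := by omega
    simp [h2]

/-- The lines on the dominoes of a tiling of the extended domain form non-intersecting paths. -/
theorem exists_paths_of_tiling (hN : 1 ≤ N) :
    ∃ u : Config (2 * N) K, IsNonIntersecting (-(N : ℤ)) u ∧ IsDrawing S u := by
  classical
  obtain ⟨u, hmono, heven, hodd⟩ := exists_levels hK S hN
  have hstep : ∀ (m : Fin N) j, oddHeight u m j = oddStep S m (evenHeight u m j) := by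
    intro m
    have hmem : ∀ j, evenHeight u m j ∈ evenLevel S m := fun j => by
      rw [← Finset.mem_coe, ← heven m m.2.le]
      exact ⟨j, rfl⟩
    have h1 : StrictMono (oddHeight u m) := hmono _
    have h2 : StrictMono (fun j => oddStep S m (evenHeight u m j)) := fun j k hjk =>
      strictMonoOn_oddStep hK S m.2 (hmem j) (hmem k) (hmono _ hjk)
    refine congrFun ((StrictMono.range_inj h1 h2).1 ?_)
    have h3 : Set.range (oddHeight u m) = oddLevel S m := hodd m m.2
    have h4 : Set.range (evenHeight u m) = evenLevel S m := heven m m.2.le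
    rw [h3, ← image_oddStep hK S m.2, ← h4, ← Set.range_comp]
    rfl
  have hinter : ∀ m : Fin N, _ := fun m => interlacing_of_card (o := oddHeight u m)
    (q := nextHeight u m) (hmono _) (hodd m m.2) (hmono _) (heven (m + 1) m.2)
    (fun y => (TileKind.east, (m : ℤ) + 1, y - K + N) ∈ S.tiles) (card_evenLevel_succ hK S m.2)
    (fun y hy => ((mem_evenLevel_succ hK S m.2).1 hy).2.2)
  have hmem : ∀ (m : Fin N) (y : ℤ), (∃ j, evenHeight u m j = y) ↔
      (TileKind.west, (m : ℤ), y - K + N) ∈ S.tiles ∨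
        (TileKind.south, (m : ℤ), y - K + N) ∈ S.tiles := by
    intro m y
    rw [← mem_evenLevel hK S m.2, ← Finset.mem_coe, ← heven m m.2.le]
    rfl
  refine ⟨u, isNonIntersecting_of_interlacing ⟨?_, ?_⟩ ?_ (fun m => (hinter m).1) hmono
    (fun m => (hinter m).2.1), ?_, ?_, ?_⟩
  · refine congrFun ((StrictMono.range_inj (g := fun j : Fin K => (j : ℤ)) (hmono 0) ?_).1 ?_)
    · exact fun j k h => by simpa using h
    · have h0 : Set.range (u 0) = evenLevel S 0 := heven 0 (by omega)
      rw [h0]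
      ext y
      rw [Finset.mem_coe, mem_evenLevel_zero hK S hN]
      constructor
      · exact fun h => ⟨⟨y.toNat, by omega⟩, by dsimp only; omega⟩
      · rintro ⟨j, rfl⟩
        dsimp only
        omega
  · refine congrFun ((StrictMono.range_inj (g := fun j : Fin K => -(N : ℤ) + j)
      (hmono (Fin.last _)) ?_).1 ?_)
    · exact fun j k h => by simpa using h
    · have h0 : Set.range (u (Fin.last _)) = evenLevel S N := heven N le_rfl
      rw [h0, evenLevel, if_pos rfl]
      ext y
      rw [Finset.mem_coe, Finset.mem_Icc]
      constructor
      · exact fun h => ⟨⟨(y + N).toNat, by omega⟩, by dsimp only; omega⟩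
      · rintro ⟨j, rfl⟩
        dsimp only
        omega
  · intro m j
    rw [hstep, oddStep]
    split_ifs
    · exact Or.inr rfl
    · exact Or.inl rfl
  · intro m x
    have hx : x + K - N - K + N = x := by ring
    have h1 := hmem m (x + K - N)
    rw [hx] at h1
    constructor
    · intro h
      obtain ⟨j, hj⟩ := h1.2 (Or.inl h)
      refine ⟨j, hj, ?_⟩
      rw [hstep, hj, oddStep, hx, if_neg fun h' => ?_]
      simpa using S.eq_of_black h h' rfl
    · rintro ⟨j, hj, h2⟩
      refine (h1.1 ⟨j, hj⟩).resolve_right fun h' => ?_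
      rw [hstep, hj, oddStep, hx, if_pos h'] at h2
      omega
  · intro m x
    have hx : x + K - N - K + N = x := by ring
    have h1 := hmem m (x + K - N)
    rw [hx] at h1
    constructor
    · intro h
      obtain ⟨j, hj⟩ := h1.2 (Or.inr h)
      refine ⟨j, hj, ?_⟩
      rw [hstep, hj, oddStep, hx, if_pos h]
    · rintro ⟨j, hj, h2⟩
      by_contra h'
      rw [hstep, hj, oddStep, hx, if_neg h'] at h2
      omega
  · intro m x
    have hx : x + K - N - K + N = x := by ring
    have h1 := (hinter m).2.2 (x + K - N)
    rwa [hx] at h1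

omit hK in
/-- The West and South dominoes determine the points of each level, and sorted points are determined
by their set. -/
theorem IsDrawing.paths_unique {u v : Config (2 * N) K} (hu : IsNonIntersecting (-(N : ℤ)) u)
    (hv : IsNonIntersecting (-(N : ℤ)) v) (hSu : IsDrawing S u) (hSv : IsDrawing S v) : u = v := by
  have heven : ∀ w : Config (2 * N) K, IsNonIntersecting (-(N : ℤ)) w → IsDrawing S w →
      ∀ m : Fin N, Set.range (evenHeight w m) =
        {y : ℤ | (TileKind.west, (m : ℤ), y - K + N) ∈ S.tiles ∨
        (TileKind.south, (m : ℤ), y - K + N) ∈ S.tiles} := by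
    intro w hw hSw m
    ext y
    rw [Set.mem_ofPred_eq, hSw.west, hSw.south]
    constructor
    · rintro ⟨j, rfl⟩
      rcases hw.odd_step m j with h | h
      · exact Or.inl ⟨j, by omega, by omega⟩
      · exact Or.inr ⟨j, by omega, by omega⟩
    · rintro (⟨j, h1, -⟩ | ⟨j, h1, -⟩) <;> exact ⟨j, by omega⟩
  have hodd : ∀ w : Config (2 * N) K, IsNonIntersecting (-(N : ℤ)) w → IsDrawing S w →
      ∀ m : Fin N, Set.range (oddHeight w m) =
        {y : ℤ | (TileKind.west, (m : ℤ), y - K + N) ∈ S.tiles ∨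
        (TileKind.south, (m : ℤ), y + 1 - K + N) ∈ S.tiles} := by
    intro w hw hSw m
    ext y
    rw [Set.mem_ofPred_eq, hSw.west, hSw.south]
    constructor
    · rintro ⟨j, rfl⟩
      rcases hw.odd_step m j with h | h
      · exact Or.inl ⟨j, by omega, by omega⟩
      · exact Or.inr ⟨j, by omega, by omega⟩
    · rintro (⟨j, -, h1⟩ | ⟨j, -, h1⟩) <;> exact ⟨j, by omega⟩
  funext i
  rcases eq_or_ne i (Fin.last _) with rfl | hi
  · funext j
    rw [hu.endpoints.2, hv.endpoints.2]
  refine (StrictMono.range_inj (hu.strictMono i) (hv.strictMono i)).1 ?_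
  obtain ⟨i, hi'⟩ := i
  rcases Nat.even_or_odd' i with ⟨m, rfl | rfl⟩
  · have hm : m < N := by
      simp only [ne_eq, Fin.ext_iff, Fin.val_last] at hi
      omega
    exact (heven u hu hSu ⟨m, hm⟩).trans (heven v hv hSv ⟨m, hm⟩).symm
  · have hm : m < N := by omega
    exact (hodd u hu hSu ⟨m, hm⟩).trans (hodd v hv hSv ⟨m, hm⟩).symm

/-- The paths determine all dominoes but the North ones, and those cover the remaining colored
squares. -/
theorem IsDrawing.tiling_unique {S S' : DominoTiling N (extendedDomain N K)}
    {u : Config (2 * N) K} (hS : IsDrawing S u) (hS' : IsDrawing S' u) : S = S' := by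
  have key : ∀ S S' : DominoTiling N (extendedDomain N K), IsDrawing S u → IsDrawing S' u →
      ∀ t ∈ S.tiles, t.1 ≠ .north → t ∈ S'.tiles := by
    rintro S S' hS hS' ⟨k, m, x⟩ ht hk
    have hw := white_bounds hK S ht
    cases k
    · exact absurd rfl hk
    · simp only [Tile.white] at hw
      obtain ⟨i, rfl⟩ : ∃ i : Fin N, m = i := ⟨⟨m.toNat, by omega⟩, by dsimp only; omega⟩
      exact (hS'.west i x).2 ((hS.west i x).1 ht)
    · simp only [Tile.white] at hw
      obtain ⟨i, rfl⟩ : ∃ i : Fin N, m = i := ⟨⟨m.toNat, by omega⟩, by dsimp only; omega⟩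
      exact (hS'.south i x).2 ((hS.south i x).1 ht)
    · simp only [Tile.white] at hw
      obtain ⟨i, rfl⟩ : ∃ i : Fin N, m = (i : ℤ) + 1 :=
        ⟨⟨(m - 1).toNat, by omega⟩, by dsimp only; omega⟩
      exact (hS'.east i x).2 ((hS.east i x).1 ht)
  have key2 : ∀ S S' : DominoTiling N (extendedDomain N K), IsDrawing S u → IsDrawing S' u →
      ∀ t ∈ S.tiles, t ∈ S'.tiles := by
    intro S S' hS hS' t ht
    by_cases hk : t.1 = .north
    · obtain ⟨t', ⟨ht', h'⟩, -⟩ := S'.covers _ (cells_subset_iff.1 (S.inside t ht)).1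
      have hb := black_mem_cells.1 h'
      by_cases hk' : t'.1 = .north
      · have : t' = t := Prod.ext (hk'.trans hk.symm) hb
        rwa [← this]
      · have := S.eq_of_black (key S' S hS' hS t' ht' hk') ht hb
        rwa [← this]
    · exact key S S' hS hS' t ht hk
  exact DominoTiling.ext (Finset.ext fun t => ⟨key2 S S' hS hS' t, key2 S' S hS' hS t⟩)

omit hK in
/-- Drawing lines on dominoes is a bijection from tilings to non-intersecting paths. -/
theorem exists_drawing_equiv (hN : 1 ≤ N) (hK : N ≤ K) :
    ∃ e : DominoTiling N (extendedDomain N K) ≃ NonIntersectingPaths N K (-(N : ℤ)),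
      ∀ S, IsDrawing S (e S).1 := by
  choose f hf hf' using fun S => exists_paths_of_tiling (K := K) hK S hN
  refine ⟨Equiv.ofBijective (fun S => ⟨f S, hf S⟩) ⟨fun S S' h => ?_, fun u => ?_⟩, hf'⟩
  · have h' : f S = f S' := congrArg Subtype.val h
    exact IsDrawing.tiling_unique hK (hf' S) (h' ▸ hf' S')
  · obtain ⟨S, hS⟩ := exists_isDrawing_of_paths hK u.2
    exact ⟨S, Subtype.ext (IsDrawing.paths_unique S (hf S) u.2 (hf' S) hS)⟩

end Levels

/-! ### Determinants of one step -/

theorem det_eq_zero_of_column_eq_smul {n : Type*} [Fintype n] [DecidableEq n] {A : Matrix n n ℝ}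
    {i j : n} (hij : i ≠ j) (a : ℝ) (h : ∀ k, A k i = a * A k j) : A.det = 0 := by
  have h1 : A = A.updateCol i (a • fun k => A k j) := by
    ext k l
    by_cases hl : l = i
    · subst hl
      simp [h]
    · simp [hl]
  rw [h1, Matrix.det_updateCol_smul, Matrix.det_zero_of_column_eq hij, mul_zero]
  intro k
  simp [hij.symm]

section Step

variable {N K : ℕ} {b c d : ℤ → ℤ → ℝ}

theorem transition_odd (m : ℕ) (x y : ℤ) : transition N K b c d (2 * m + 1) x y =
    if y = x then b m (x - K + N) else if y = x - 1 then c m (x - K + N) else 0 := by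
  have h1 : Odd (2 * m + 1) := odd_two_mul_add_one m
  have h2 : (2 * m + 1) / 2 = m := by omega
  rw [transition, if_pos h1, h2]

theorem transition_even (m : ℕ) (x y : ℤ) : transition N K b c d (2 * m) x y =
    if y ≤ x then ∏ k ∈ Finset.Icc (y + 1) x, d m (k - K + N) else 0 := by
  have h1 : ¬ Odd (2 * m) := by simp
  have h2 : 2 * m / 2 = m := by omega
  rw [transition, if_neg h1, h2]

/-- Between sorted points, only the identity permutation contributes to the determinant of a
Bernoulli step. -/
theorem det_transition_odd (m : ℕ) {x y : Fin K → ℤ} (hx : StrictMono x) (hy : StrictMono y) :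
    (Matrix.of fun j k : Fin K => transition N K b c d (2 * m + 1) (x j) (y k)).det =
      ∏ j, transition N K b c d (2 * m + 1) (x j) (y j) := by
  rw [← Matrix.det_transpose, Matrix.det_apply', Finset.sum_eq_single 1]
  · simp
  · intro σ _ hσ
    rw [mul_eq_zero]
    right
    by_contra hne
    have hne := Finset.prod_ne_zero_iff.1 hne
    have hstep : ∀ j, y (σ j) = x j ∨ y (σ j) = x j - 1 := by
      intro j
      have := hne j (Finset.mem_univ j)
      simp only [Matrix.transpose_apply, Matrix.of_apply, transition_odd] at this
      by_contra h
      push Not at h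
      rw [if_neg h.1, if_neg h.2] at this
      exact this rfl
    have hmono : Monotone σ := by
      intro j k hjk
      rcases hjk.eq_or_lt with rfl | hjk
      · exact le_rfl
      · refine hy.le_iff_le.1 ?_
        have h1 := hstep j
        have h2 := hstep k
        have h3 := hx hjk
        omega
    refine hσ (Equiv.ext fun j => ?_)
    have := (StrictMono.range_inj (hmono.strictMono_of_injective σ.injective) strictMono_id).1
      (by rw [σ.surjective.range_eq, Set.range_id])
    exact congrFun this j
  · simp

/-- Between sorted interlacing points, the matrix of a geometric step is lower triangular. -/
theorem det_transition_even (m : ℕ) {x y : Fin K → ℤ} (hgap : ∀ j k, j < k → x j < y k) :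
    (Matrix.of fun j k : Fin K => transition N K b c d (2 * m) (x j) (y k)).det =
      ∏ j, transition N K b c d (2 * m) (x j) (y j) := by
  rw [Matrix.det_of_isLowerTriangular]
  · rfl
  · intro j k hjk
    rw [Matrix.of_apply, transition_even, if_neg (by have := hgap j k hjk; omega)]

/-- If sorted points do not interlace, then the matrix of a geometric step has two proportional
columns: at the first `j` with `y (j+1) ≤ x j`, the columns `j` and `j+1` both vanish above row `j`,
and below they differ by the weight of the way from `y (j+1)` to `y j`. -/
theorem gap_of_det_transition_even_ne_zero (m : ℕ) {x y : Fin K → ℤ} (hx : StrictMono x)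
    (hy : StrictMono y)
    (hdet : (Matrix.of fun j k : Fin K => transition N K b c d (2 * m) (x j) (y k)).det ≠ 0) :
    ∀ j k, j < k → x j < y k := by
  by_contra hcon
  have hex : ∃ j : ℕ, ∃ h : j + 1 < K, y ⟨j + 1, h⟩ ≤ x ⟨j, by omega⟩ := by
    push Not at hcon
    obtain ⟨j, k, hjk, h⟩ := hcon
    have hjk' : (j : ℕ) < k := hjk
    have : y ⟨j + 1, by omega⟩ ≤ y k := hy.monotone (by rw [Fin.le_def]; exact hjk')
    exact ⟨j, by omega, this.trans h⟩
  classical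
  obtain ⟨hj, hle⟩ := Nat.find_spec hex
  have hmin := fun i => @Nat.find_min _ _ hex i
  generalize Nat.find hex = j at *
  have hlt : y ⟨j, by omega⟩ < y ⟨j + 1, hj⟩ := hy (by rw [Fin.lt_def]; simp)
  refine hdet (det_eq_zero_of_column_eq_smul (i := ⟨j, by omega⟩) (j := ⟨j + 1, hj⟩) (by simp)
    (∏ k ∈ Finset.Icc (y ⟨j, by omega⟩ + 1) (y ⟨j + 1, hj⟩), d m (k - K + N)) fun i => ?_)
  simp only [Matrix.of_apply, transition_even]
  rcases Nat.lt_or_ge i j with hij | hij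
  · have h1 : x i < y ⟨i + 1, by omega⟩ := by
      by_contra h
      exact hmin i hij ⟨by omega, not_lt.1 h⟩
    have h2 : y ⟨i + 1, by omega⟩ ≤ y ⟨j, by omega⟩ := hy.monotone (by rw [Fin.le_def]; exact hij)
    rw [if_neg (by omega), if_neg (by omega), mul_zero]
  · have h1 : x ⟨j, by omega⟩ ≤ x i := hx.monotone hij
    rw [if_pos (by omega), if_pos (by omega), ← Finset.prod_union]
    · congr 1
      ext k
      simp only [Finset.mem_union, Finset.mem_Icc]
      omega
    · refine Finset.disjoint_left.2 fun k => ?_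
      simp only [Finset.mem_Icc]
      omega

end Step

/-! ### The product of determinants -/

theorem prod_fin_two_mul (N : ℕ) (f : Fin (2 * N) → ℝ) :
    ∏ i, f i = ∏ m : Fin N, f ⟨2 * m, by omega⟩ * f ⟨2 * m + 1, by omega⟩ := by
  induction N with
  | zero => simp
  | succ N ih =>
    rw [Fin.prod_univ_castSucc (n := N)]
    have h := Fin.prod_univ_castSucc (n := 2 * N + 1) f
    rw [Fin.prod_univ_castSucc (n := 2 * N), ih] at h
    rw [show ∏ i, f i = ∏ i : Fin (2 * N + 1 + 1), f i from rfl, h, mul_assoc]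
    rfl

/-- Permutations of the labels at each level, trivial at the two ends. -/
abbrev LevelPerms (L K : ℕ) : Type :=
  {σ : Fin (L + 1) → Equiv.Perm (Fin K) // σ 0 = 1 ∧ σ (Fin.last L) = 1}

/-- The configuration `u` with permuted labels. -/
def relabel {L K : ℕ} (u : Config L K) (σ : Fin (L + 1) → Equiv.Perm (Fin K)) : Config L K :=
  fun i j => u i (σ i j)

theorem hasEndpoints_relabel {L K : ℕ} {s : ℤ} {u : Config L K} (σ : LevelPerms L K) :
    HasEndpoints s (relabel u σ.1) ↔ HasEndpoints s u := by
  simp [HasEndpoints, relabel, σ.2.1, σ.2.2]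

/-- Each interior permutation contributes its sign to two determinants. -/
theorem detWeight_relabel {L K : ℕ} (s : ℤ) (T : ℕ → ℤ → ℤ → ℝ) (u : Config L K)
    (σ : LevelPerms L K) : detWeight L K s T (relabel u σ.1) = detWeight L K s T u := by
  by_cases he : HasEndpoints s u
  swap
  · rw [detWeight, detWeight, if_neg he, if_neg (mt (hasEndpoints_relabel σ).1 he)]
  rw [detWeight, detWeight, if_pos he, if_pos ((hasEndpoints_relabel σ).2 he)]
  have hdet : ∀ i : Fin L, (Matrix.of fun j k : Fin K =>
      T (i + 1) (relabel u σ.1 i.castSucc j) (relabel u σ.1 i.succ k)).det =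
      (((Equiv.Perm.sign (σ.1 i.castSucc) : ℤ) : ℝ) * ((Equiv.Perm.sign (σ.1 i.succ) : ℤ) : ℝ)) *
      (Matrix.of fun j k : Fin K => T (i + 1) (u i.castSucc j) (u i.succ k)).det := by
    intro i
    rw [mul_assoc, ← Matrix.det_permute' (σ.1 i.succ), ← Matrix.det_permute (σ.1 i.castSucc)]
    rfl
  rw [Finset.prod_congr rfl fun i _ => hdet i, Finset.prod_mul_distrib, Finset.prod_mul_distrib]
  have h1 := Fin.prod_univ_castSucc fun i => ((Equiv.Perm.sign (σ.1 i) : ℤ) : ℝ)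
  have h2 := Fin.prod_univ_succ fun i => ((Equiv.Perm.sign (σ.1 i) : ℤ) : ℝ)
  rw [h1] at h2
  simp only [σ.2.1, σ.2.2, Equiv.Perm.sign_one, Units.val_one, Int.cast_one, mul_one, one_mul] at h2
  rw [h2, ← Finset.prod_mul_distrib, Finset.prod_eq_one, one_mul]
  intro i _
  rcases Int.units_eq_one_or (Equiv.Perm.sign (σ.1 i.succ)) with h | h <;> simp [h]

theorem injective_of_detWeight_ne_zero {L K : ℕ} {s : ℤ} {T : ℕ → ℤ → ℤ → ℝ} {u : Config L K}
    (hu : detWeight L K s T u ≠ 0) (i : Fin (L + 1)) : Function.Injective (u i) := by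
  have he : HasEndpoints s u := by
    by_contra h
    exact hu (if_neg h)
  rw [detWeight, if_pos he] at hu
  have hu := Finset.prod_ne_zero_iff.1 hu
  intro j k hjk
  by_contra hne
  induction i using Fin.cases with
  | zero =>
    rw [he.1, he.1] at hjk
    exact hne (Fin.ext (by exact_mod_cast hjk))
  | succ i =>
    exact hu i (Finset.mem_univ i) (Matrix.det_zero_of_column_eq hne fun l => by
      simp only [Matrix.of_apply, hjk])

theorem relabel_injective {L K : ℕ} {u : Config L K} (hu : ∀ i, Function.Injective (u i)) :
    Function.Injective (relabel u) := by
  intro σ τ h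
  funext i
  ext j
  exact congrArg Fin.val (hu i (congrFun (congrFun h i) j))

section Weights

variable {N K : ℕ} {b c d : ℤ → ℤ → ℝ} {u : Config (2 * N) K}

theorem detWeight_of_isNonIntersecting (hu : IsNonIntersecting (-(N : ℤ)) u) :
    detWeight (2 * N) K (-(N : ℤ)) (transition N K b c d) u = ∏ m : Fin N,
      ((∏ j, transition N K b c d (2 * m + 1) (evenHeight u m j) (oddHeight u m j)) *
        ∏ j, transition N K b c d (2 * (m + 1)) (oddHeight u m j) (nextHeight u m j)) := by
  rw [detWeight, if_pos hu.endpoints, prod_fin_two_mul]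
  refine Finset.prod_congr rfl fun m _ => ?_
  congr 1
  · exact det_transition_odd m (hu.strictMono _) (hu.strictMono _)
  · exact det_transition_even (m + 1) fun j k => hu.gap m

/-- For sorted levels, a non-zero factor forces the points to be those of one step of disjoint
paths. -/
theorem isNonIntersecting_of_detWeight_ne_zero (hs : ∀ i, StrictMono (u i))
    (hu : detWeight (2 * N) K (-(N : ℤ)) (transition N K b c d) u ≠ 0) :
    IsNonIntersecting (-(N : ℤ)) u := by
  have he : HasEndpoints (-(N : ℤ)) u := by
    by_contra h
    exact hu (if_neg h)
  rw [detWeight, if_pos he, prod_fin_two_mul] at hu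
  have hu := Finset.prod_ne_zero_iff.1 hu
  have hodd : ∀ m : Fin N, (Matrix.of fun j k : Fin K =>
      transition N K b c d (2 * m + 1) (evenHeight u m j) (oddHeight u m k)).det ≠ 0 := fun m =>
    left_ne_zero_of_mul (hu m (Finset.mem_univ m))
  have heven : ∀ m : Fin N, (Matrix.of fun j k : Fin K =>
      transition N K b c d (2 * (m + 1)) (oddHeight u m j) (nextHeight u m k)).det ≠ 0 := fun m =>
    right_ne_zero_of_mul (hu m (Finset.mem_univ m))
  have hgap : ∀ (m : Fin N) (j k : Fin K), j < k → oddHeight u m j < nextHeight u m k := fun m =>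
    gap_of_det_transition_even_ne_zero (m + 1) (hs _) (hs _) (heven m)
  refine isNonIntersecting_of_interlacing he (fun m j => ?_) (fun m j => ?_) hs hgap
  · have h := hodd m
    rw [det_transition_odd m (x := evenHeight u m) (y := oddHeight u m) (hs _) (hs _)] at h
    have h := Finset.prod_ne_zero_iff.1 h j (Finset.mem_univ j)
    rw [transition_odd] at h
    by_contra hcon
    push Not at hcon
    rw [if_neg hcon.1, if_neg hcon.2] at h
    exact h rfl
  · have h := heven m
    rw [det_transition_even (m + 1) (hgap m)] at h
    have h := Finset.prod_ne_zero_iff.1 h j (Finset.mem_univ j)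
    rw [transition_even] at h
    by_contra hcon
    rw [if_neg hcon] at h
    exact h rfl

/-- The product of determinants is carried by the non-intersecting paths with permuted labels. -/
theorem exists_relabel_of_detWeight_ne_zero
    (hu : detWeight (2 * N) K (-(N : ℤ)) (transition N K b c d) u ≠ 0) :
    ∃ (v : NonIntersectingPaths N K (-(N : ℤ))) (σ : LevelPerms (2 * N) K),
      relabel v.1 σ.1 = u := by
  have hinj := injective_of_detWeight_ne_zero hu
  have he : HasEndpoints (-(N : ℤ)) u := by
    by_contra h
    exact hu (if_neg h)
  have h0 : Tuple.sort (u 0) = 1 := Tuple.sort_eq_refl_iff_monotone.2 fun j k hjk => by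
    rw [he.1, he.1]
    exact_mod_cast hjk
  have hL : Tuple.sort (u (Fin.last _)) = 1 := Tuple.sort_eq_refl_iff_monotone.2 fun j k hjk => by
    rw [he.2, he.2]
    simpa using hjk
  let σ : LevelPerms (2 * N) K := ⟨fun i => Tuple.sort (u i), h0, hL⟩
  let τ : LevelPerms (2 * N) K := ⟨fun i => (Tuple.sort (u i))⁻¹, by simp [h0], by simp [hL]⟩
  have hs : ∀ i, StrictMono (relabel u σ.1 i) := fun i =>
    (Tuple.monotone_sort (u i)).strictMono_of_injective ((hinj i).comp (Equiv.injective _))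
  refine ⟨⟨relabel u σ.1, isNonIntersecting_of_detWeight_ne_zero (b := b) (c := c) (d := d) hs ?_⟩,
    τ, ?_⟩
  · rwa [detWeight_relabel]
  · funext i j
    simp [relabel, σ, τ]

/-- The weight of a tiling of the extended domain is the product of the weights of the steps of its
paths. -/
theorem tilingWeight_eq_of_isDrawing (hK : N ≤ K) {S : DominoTiling N (extendedDomain N K)}
    (hu : IsNonIntersecting (-(N : ℤ)) u) (hS : IsDrawing S u) :
    tilingWeight b c d S = ∏ m : Fin N,
      ((∏ j, transition N K b c d (2 * m + 1) (evenHeight u m j) (oddHeight u m j)) *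
        ∏ j, transition N K b c d (2 * (m + 1)) (oddHeight u m j) (nextHeight u m j)) := by
  classical
  have hsplit : tilingWeight b c d S =
      (∏ t ∈ S.tiles.filter fun t => t.1 = .west ∨ t.1 = .south, tileWeight b c d t) *
        ∏ t ∈ S.tiles.filter fun t => t.1 = .east, tileWeight b c d t := by
    rw [tilingWeight, Finset.prod_filter, Finset.prod_filter, ← Finset.prod_mul_distrib]
    refine Finset.prod_congr rfl ?_
    rintro ⟨k, m, x⟩ -
    cases k <;> simp [tileWeight]
  have heven : ∀ (m : Fin N) (j k : Fin K), evenHeight u m j = evenHeight u m k → j = k :=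
    fun m j k h => (hu.strictMono _).injective h
  rw [hsplit, Finset.prod_mul_distrib]
  congr 1
  · rw [← Fintype.prod_prod_type']
    symm
    refine Finset.prod_bij (fun q _ => (if oddHeight u q.1 q.2 = evenHeight u q.1 q.2 then .west
      else .south, (q.1 : ℤ), evenHeight u q.1 q.2 - K + N)) ?_ ?_ ?_ ?_
    · rintro ⟨m, j⟩ -
      rw [Finset.mem_filter]
      dsimp only
      split_ifs with h
      · exact ⟨(hS.west m _).2 ⟨j, by ring, by rw [h]; ring⟩, Or.inl rfl⟩
      · refine ⟨(hS.south m _).2 ⟨j, by ring, ?_⟩, Or.inr rfl⟩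
        rw [(hu.odd_step m j).resolve_left h]
        ring
    · rintro ⟨m, j⟩ - ⟨m', j'⟩ - h
      simp only [Prod.mk.injEq] at h
      obtain rfl : m = m' := Fin.ext (by omega)
      obtain rfl := heven m j j' (by omega)
      rfl
    · rintro ⟨k, m, x⟩ ht
      obtain ⟨ht, hk⟩ := Finset.mem_filter.1 ht
      have hw := white_bounds hK S ht
      obtain ⟨i, rfl⟩ : ∃ i : Fin N, m = i := by
        have hm : 0 ≤ m ∧ m ≤ N - 1 := by
          rcases hk with rfl | rfl <;> exact ⟨hw.1, hw.2.1⟩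
        exact ⟨⟨m.toNat, by omega⟩, by dsimp only; omega⟩
      rcases hk with rfl | rfl
      · obtain ⟨j, h1, h2⟩ := (hS.west i x).1 ht
        refine ⟨(i, j), Finset.mem_univ _, ?_⟩
        dsimp only
        rw [if_pos (h2.trans h1.symm), h1]
        congr 2
        ring
      · obtain ⟨j, h1, h2⟩ := (hS.south i x).1 ht
        refine ⟨(i, j), Finset.mem_univ _, ?_⟩
        dsimp only
        rw [if_neg (by omega), h1]
        congr 2
        ring
    · rintro ⟨m, j⟩ -
      dsimp only
      rw [transition_odd]
      by_cases h : oddHeight u m j = evenHeight u m j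
      · rw [if_pos h, if_pos h]
        rfl
      · rw [if_neg h, if_neg h, if_pos ((hu.odd_step m j).resolve_left h)]
        rfl
  · have hT : ∀ (m : Fin N) (j : Fin K),
        transition N K b c d (2 * (m + 1)) (oddHeight u m j) (nextHeight u m j) =
        ∏ y ∈ Finset.Icc (nextHeight u m j + 1) (oddHeight u m j),
          d ((m : ℤ) + 1) (y - K + N) := fun m j => by
      rw [transition_even, if_pos (hu.even_step m j)]
      push_cast
      rfl
    simp only [hT]
    rw [← Fintype.prod_prod_type', Finset.prod_sigma']
    symm
    refine Finset.prod_bij (fun q _ => (.east, (q.1.1 : ℤ) + 1, q.2 - K + N)) ?_ ?_ ?_ ?_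
    · rintro ⟨⟨m, j⟩, y⟩ hq
      simp only [Finset.mem_sigma, Finset.mem_univ, true_and, Finset.mem_Icc] at hq
      exact Finset.mem_filter.2 ⟨(hS.east m _).2 ⟨j, by dsimp only; omega, by dsimp only; omega⟩,
        rfl⟩
    · rintro ⟨⟨m, j⟩, y⟩ hq ⟨⟨m', j'⟩, y'⟩ hq' h
      have hq1 : nextHeight u m j + 1 ≤ y ∧ y ≤ oddHeight u m j := by simpa using hq
      have hq2 : nextHeight u m' j' + 1 ≤ y' ∧ y' ≤ oddHeight u m' j' := by simpa using hq'
      simp only [Prod.mk.injEq, true_and] at h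
      obtain rfl : m = m' := Fin.ext (by omega)
      have hy : y = y' := by omega
      subst hy
      obtain rfl := hu.path_unique (m := m) (j := j) (k := j') (y := y) (by omega) (by omega)
      rfl
    · rintro ⟨k, m, x⟩ ht
      obtain ⟨ht, hk⟩ := Finset.mem_filter.1 ht
      obtain rfl : k = .east := hk
      have hw := white_bounds hK S ht
      simp only [Tile.white] at hw
      obtain ⟨i, rfl⟩ : ∃ i : Fin N, m = (i : ℤ) + 1 :=
        ⟨⟨(m - 1).toNat, by omega⟩, by dsimp only; omega⟩
      obtain ⟨j, h1, h2⟩ := (hS.east i x).1 ht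
      refine ⟨⟨(i, j), x + K - N⟩, ?_, ?_⟩
      · simp only [Finset.mem_sigma, Finset.mem_univ, true_and, Finset.mem_Icc]
        omega
      · dsimp only
        congr 2
        ring
    · rintro ⟨⟨m, j⟩, y⟩ -
      rfl

theorem detWeight_eq_tilingWeight (hK : N ≤ K) {S : DominoTiling N (extendedDomain N K)}
    (hu : IsNonIntersecting (-(N : ℤ)) u) (hS : IsDrawing S u) :
    detWeight (2 * N) K (-(N : ℤ)) (transition N K b c d) u = tilingWeight b c d S := by
  rw [detWeight_of_isNonIntersecting hu, tilingWeight_eq_of_isDrawing hK hu hS]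

end Weights

theorem tilingWeight_pos {N K : ℕ} (hK : N ≤ K) {b c d : ℤ → ℤ → ℝ}
    (hb : ∀ m x : ℤ, 0 ≤ m → m ≤ N → 0 < b m x) (hc : ∀ m x : ℤ, 0 ≤ m → m ≤ N → 0 < c m x)
    (hd : ∀ m x : ℤ, 0 ≤ m → m ≤ N → 0 < d m x) {R : Set (ℤ × ℤ)} (hR : R ⊆ extendedDomain N K)
    (S : DominoTiling N R) : 0 < tilingWeight b c d S := by
  refine Finset.prod_pos fun t ht => ?_
  have h := (black_mem_extendedDomain hK).1 (hR (cells_subset_iff.1 (S.inside t ht)).1)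
  obtain ⟨k, m, x⟩ := t
  cases k
  · exact one_pos
  · exact hb m x h.1 h.2.1
  · exact hc m x h.1 h.2.1
  · exact hd m x h.1 h.2.1

/-- There are non-intersecting paths: those that go down by one in each step from level `2m` to
level `2m+1`, and stay at their height otherwise. -/
theorem nonempty_paths (N K : ℕ) : Nonempty (NonIntersectingPaths N K (-(N : ℤ))) := by
  have h1 : ∀ m : ℕ, (2 * m + 1 + 1) / 2 = m + 1 := fun m => by omega
  have h2 : ∀ m : ℕ, (2 * m + 1) / 2 = m := fun m => by omega
  have h3 : ∀ m : ℕ, (2 * m + 2 + 1) / 2 = m + 1 := fun m => by omega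
  refine ⟨⟨fun i j => (j : ℤ) - (((i : ℕ) + 1) / 2 : ℕ), isNonIntersecting_of_interlacing
    ⟨fun j => by simp, fun j => ?_⟩ (fun m j => Or.inr ?_) (fun m j => ?_) (fun i j k h => ?_)
    fun m j k h => ?_⟩⟩
  · simp only [Fin.val_last, h2]
    ring
  · simp only [oddHeight, evenHeight, h1, h2]
    push_cast
    ring
  · simp only [oddHeight, nextHeight, h1, h3]
    exact le_rfl
  · have : (j : ℕ) < k := h
    omega
  · simp only [oddHeight, nextHeight, h1, h3]
    have : (j : ℕ) < k := h
    omega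

/-! ### Normalized measures -/

section Measure

variable {α β γ : Type*} [MeasurableSpace α] [MeasurableSpace β]

theorem isProbabilityMeasure_normalizedMeasure {w : α → ℝ} (h0 : ∀ a, 0 ≤ w a) (hs : Summable w)
    (hpos : ∃ a, 0 < w a) : IsProbabilityMeasure (normalizedMeasure w) := by
  obtain ⟨a, ha⟩ := hpos
  have hZ : 0 < ∑' a, w a := hs.tsum_pos h0 a ha
  constructor
  rw [normalizedMeasure, Measure.sum_apply _ MeasurableSet.univ]
  simp only [Measure.smul_apply, measure_univ, smul_eq_mul, mul_one]
  rw [← ENNReal.ofReal_tsum_of_nonneg (fun a => div_nonneg (h0 a) hZ.le) (hs.div_const _),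
    tsum_div_const, div_self hZ.ne', ENNReal.ofReal_one]

theorem ae_normalizedMeasure [Countable α] [MeasurableSingletonClass α] {w : α → ℝ} {P : α → Prop}
    (h : ∀ a, w a ≠ 0 → P a) : ∀ᵐ a ∂(normalizedMeasure w), P a := by
  rw [normalizedMeasure, Measure.ae_sum_iff]
  intro a
  by_cases ha : w a = 0
  · simp [ha]
  · refine Measure.ae_smul_measure ?_ _
    rw [ae_dirac_eq]
    exact h a ha

/-- If the points of positive weight are parametrized by pairs, and the weight is a product of a
factor for each member of a pair, then the first member of the pair is distributed according to its
own factor. -/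
theorem map_normalizedMeasure [Finite β] [Finite γ] {Φ : β × γ → α} (hΦ : Function.Injective Φ)
    {w : α → ℝ} {v : β → ℝ} {κ : γ → ℝ} (hw : ∀ q, w (Φ q) = v q.1 * κ q.2)
    (h0 : ∀ a, a ∉ Set.range Φ → w a = 0) (hv : ∀ b, 0 ≤ v b) (hκ : ∀ g, 0 ≤ κ g)
    (hκ0 : ∃ g, 0 < κ g) {f : α → β} (hf : Measurable f) (hfΦ : ∀ q, f (Φ q) = q.1) :
    Measure.map f (normalizedMeasure w) = normalizedMeasure v := by
  have := Fintype.ofFinite β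
  have := Fintype.ofFinite γ
  have hκpos : 0 < ∑ g, κ g := by
    obtain ⟨g, hg⟩ := hκ0
    exact Finset.sum_pos' (fun g _ => hκ g) ⟨g, Finset.mem_univ g, hg⟩
  have hV : 0 ≤ ∑ b, v b := Finset.sum_nonneg fun b _ => hv b
  have hZ : ∑' a, w a = (∑ b, v b) * ∑ g, κ g := by
    rw [← hΦ.tsum_eq fun a ha => by
      by_contra h
      exact ha (h0 a h), tsum_fintype, Fintype.sum_prod_type, Finset.sum_mul_sum]
    simp only [hw]
  refine Measure.ext fun s hs => ?_
  rw [Measure.map_apply hf hs, normalizedMeasure, normalizedMeasure,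
    Measure.sum_apply _ (hf hs), Measure.sum_apply _ hs]
  simp only [Measure.smul_apply, smul_eq_mul, Measure.dirac_apply' _ (hf hs),
    Measure.dirac_apply' _ hs, hZ, tsum_fintype]
  rw [← hΦ.tsum_eq fun a ha => by
    by_contra h
    exact ha (by simp [h0 a h]), tsum_fintype, Fintype.sum_prod_type]
  refine Finset.sum_congr rfl fun b _ => ?_
  have hind : ∀ g, (f ⁻¹' s).indicator (1 : α → ENNReal) (Φ (b, g)) = s.indicator 1 b := fun g => by
    classical
    simp only [Set.indicator_apply, Set.mem_preimage, hfΦ, Pi.one_apply]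
  simp only [hind, hw]
  rw [← Finset.sum_mul]
  congr 1
  have hfac : ∀ g, v b * κ g / ((∑ b, v b) * ∑ g, κ g) = v b / (∑ b, v b) * (κ g / ∑ g, κ g) :=
    fun g => by rw [mul_div_mul_comm]
  simp only [hfac]
  rw [← ENNReal.ofReal_sum_of_nonneg fun g _ => mul_nonneg (div_nonneg (hv b) hV)
    (div_nonneg (hκ g) hκpos.le), ← Finset.mul_sum, ← Finset.sum_div, div_self hκpos.ne', mul_one]

end Measure

/-! ### The measure on non-intersecting paths and on tilings -/

theorem transition_add_period {p N K : ℕ} {b c d : ℤ → ℤ → ℝ}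
    (hbp : ∀ m x : ℤ, 0 ≤ m → m ≤ N → b m (x + p) = b m x)
    (hcp : ∀ m x : ℤ, 0 ≤ m → m ≤ N → c m (x + p) = c m x)
    (hdp : ∀ m x : ℤ, 0 ≤ m → m ≤ N → d m (x + p) = d m x) {i : ℕ} (hi : i ≤ 2 * N) (x y : ℤ) :
    transition N K b c d i (x + p) (y + p) = transition N K b c d i x y := by
  rcases Nat.even_or_odd' i with ⟨m, rfl | rfl⟩
  · rw [transition_even, transition_even]
    refine if_congr (by omega) ?_ rfl
    refine Finset.prod_nbij' (fun k => k - (p : ℤ)) (fun k => k + (p : ℤ)) ?_ ?_ ?_ ?_ ?_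
    · intro k hk
      rw [Finset.mem_Icc] at hk ⊢
      omega
    · intro k hk
      rw [Finset.mem_Icc] at hk ⊢
      omega
    · intro k _
      ring
    · intro k _
      ring
    · intro k _
      rw [← hdp m (k - p - K + N) (by omega) (by omega)]
      congr 1
      ring
  · rw [transition_odd, transition_odd, ← hbp m (x - K + N) (by omega) (by omega),
      ← hcp m (x - K + N) (by omega) (by omega)]
    have e : x + p - K + N = x - K + N + (p : ℤ) := by ring
    rw [e]
    exact if_congr (by omega) rfl (if_congr (by omega) rfl rfl)

section Final

variable {N K : ℕ}

theorem range_relabel {L : ℕ} (u : Config L K) (σ : Fin (L + 1) → Equiv.Perm (Fin K))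
    (i : Fin (L + 1)) : Set.range (relabel u σ i) = Set.range (u i) :=
  (σ i).surjective.range_comp (u i)

theorem IsNonIntersecting.eq_of_range_eq {s : ℤ} {u v : Config (2 * N) K}
    (hu : IsNonIntersecting s u) (hv : IsNonIntersecting s v)
    (h : ∀ i, Set.range (u i) = Set.range (v i)) : u = v :=
  funext fun i => (StrictMono.range_inj (hu.strictMono i) (hv.strictMono i)).1 (h i)

open Classical in
/-- The non-intersecting paths with the same points on each level as a given configuration, and
arbitrary ones if there are none. -/
noncomputable def sortedPaths (N K : ℕ) (u : Config (2 * N) K) :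
    NonIntersectingPaths N K (-(N : ℤ)) :=
  if h : ∃ v : NonIntersectingPaths N K (-(N : ℤ)), ∀ i, Set.range (v.1 i) = Set.range (u i) then
    h.choose
  else (nonempty_paths N K).some

theorem sortedPaths_eq {v : NonIntersectingPaths N K (-(N : ℤ))} {u : Config (2 * N) K}
    (h : ∀ i, Set.range (v.1 i) = Set.range (u i)) : sortedPaths N K u = v := by
  have hex : ∃ v : NonIntersectingPaths N K (-(N : ℤ)), ∀ i, Set.range (v.1 i) = Set.range (u i) :=
    ⟨v, h⟩
  rw [sortedPaths, dif_pos hex]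
  exact Subtype.ext (hex.choose.2.eq_of_range_eq v.2 fun i =>
    (hex.choose_spec i).trans (h i).symm)

/-- The assertions about the measure, the drawing bijection and the decoupling, for any number
`K ≥ N` of paths. -/
theorem paths_tilings_measure (hN : 1 ≤ N) (hK : N ≤ K) {b c d : ℤ → ℤ → ℝ}
    (hb : ∀ m x : ℤ, 0 ≤ m → m ≤ N → 0 < b m x)
    (hc : ∀ m x : ℤ, 0 ≤ m → m ≤ N → 0 < c m x)
    (hd : ∀ m x : ℤ, 0 ≤ m → m ≤ N → 0 < d m x) :
    (∀ u, 0 ≤ detWeight (2 * N) K (-(N : ℤ)) (transition N K b c d) u) ∧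
    IsProbabilityMeasure (detMeasure (2 * N) K (-(N : ℤ)) (transition N K b c d)) ∧
    ∃ (paths : Config (2 * N) K → NonIntersectingPaths N K (-(N : ℤ)))
      (e : DominoTiling N (extendedDomain N K) ≃ NonIntersectingPaths N K (-(N : ℤ)))
      (r : DominoTiling N (extendedDomain N K) → DominoTiling N (aztecDiamond N)),
      (∀ᵐ u ∂(detMeasure (2 * N) K (-(N : ℤ)) (transition N K b c d)),
        ∀ i, Set.range ((paths u).1 i) = Set.range (u i)) ∧
      (∀ S, IsDrawing S (e S).1) ∧
      (∀ S : DominoTiling N (extendedDomain N K),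
        ∀ t ∈ S.tiles, Tile.cells N t ⊆ aztecDiamond N ∨
        (Tile.cells N t ⊆ corridor N K ∧ t.1 = TileKind.south) ∨
        Tile.cells N t ⊆ lowerDiamond N K) ∧
      (∀ (S : DominoTiling N (extendedDomain N K)) (t : Tile),
        t ∈ (r S).tiles ↔ t ∈ S.tiles ∧ Tile.cells N t ⊆ aztecDiamond N) ∧
      Measure.map (fun u => r (e.symm (paths u)))
          (detMeasure (2 * N) K (-(N : ℤ)) (transition N K b c d)) =
        normalizedMeasure
          (tilingWeight b c d : DominoTiling N (aztecDiamond N) → ℝ) := by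
  obtain ⟨e, he⟩ := exists_drawing_equiv hN hK
  -- The configurations of positive weight correspond to the tilings of the two Aztec diamonds and
  -- the permutations of the labels. The weight depends on the latter two through a separate factor.
  have := finite_dominoTiling N (finite_aztecDiamond N)
  have := finite_dominoTiling N (finite_lowerDiamond N K)
  let Φ : DominoTiling N (aztecDiamond N) ×
      (DominoTiling N (lowerDiamond N K) × LevelPerms (2 * N) K) → Config (2 * N) K :=
    fun q => relabel (e (decouple hK (q.1, q.2.1))).1 q.2.2.1
  have hpaths : ∀ (v : NonIntersectingPaths N K (-(N : ℤ))) (σ : LevelPerms (2 * N) K),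
      sortedPaths N K (relabel v.1 σ.1) = v := fun v σ =>
    sortedPaths_eq fun i => (range_relabel _ _ i).symm
  have hsorted : ∀ q, sortedPaths N K (Φ q) = e (decouple hK (q.1, q.2.1)) := fun q => hpaths _ _
  have hΦ : Function.Injective Φ := by
    rintro ⟨A, B, σ⟩ ⟨A', B', σ'⟩ h
    have h1 := (decouple hK).injective (e.injective
      ((hsorted (A, B, σ)).symm.trans ((congrArg _ h).trans (hsorted (A', B', σ')))))
    obtain ⟨rfl, rfl⟩ := Prod.mk.inj h1
    have h2 : σ = σ' := Subtype.ext (relabel_injective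
      (fun i => ((e (decouple hK (A, B))).2.strictMono i).injective) h)
    rw [h2]
  have hw : ∀ q, detWeight (2 * N) K (-(N : ℤ)) (transition N K b c d) (Φ q) =
      tilingWeight b c d q.1 *
        (tilingWeight b c d (corridorTiling N K) * tilingWeight b c d q.2.1) := by
    rintro ⟨A, B, σ⟩
    rw [← tilingWeight_glue hK]
    exact (detWeight_relabel _ _ _ σ).trans
      (detWeight_eq_tilingWeight hK (Subtype.property _) (he _))
  have hrange : ∀ u, detWeight (2 * N) K (-(N : ℤ)) (transition N K b c d) u ≠ 0 →
      u ∈ Set.range Φ := by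
    intro u hu
    obtain ⟨v, σ, rfl⟩ := exists_relabel_of_detWeight_ne_zero hu
    exact ⟨(((decouple hK).symm (e.symm v)).1, ((decouple hK).symm (e.symm v)).2, σ), by simp [Φ]⟩
  have hA : ∀ A : DominoTiling N (aztecDiamond N), 0 < tilingWeight b c d A :=
    tilingWeight_pos hK hb hc hd fun _ h => Or.inl (Or.inl h)
  have hB : ∀ B : DominoTiling N (lowerDiamond N K),
      0 < tilingWeight b c d (corridorTiling N K) * tilingWeight b c d B := fun B =>
    mul_pos (tilingWeight_pos hK hb hc hd (fun _ h => Or.inl (Or.inr h)) _)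
      (tilingWeight_pos hK hb hc hd (fun _ h => Or.inr h) _)
  have h0 : ∀ u, u ∉ Set.range Φ →
      detWeight (2 * N) K (-(N : ℤ)) (transition N K b c d) u = 0 := fun u hu => by
    by_contra h
    exact hu (hrange u h)
  have hnonneg : ∀ u, 0 ≤ detWeight (2 * N) K (-(N : ℤ)) (transition N K b c d) u := by
    intro u
    by_cases hu : u ∈ Set.range Φ
    · obtain ⟨q, rfl⟩ := hu
      rw [hw]
      exact (mul_pos (hA _) (hB _)).le
    · exact (h0 u hu).ge
  let v₀ := (nonempty_paths N K).some
  let q₀ : DominoTiling N (aztecDiamond N) ×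
      (DominoTiling N (lowerDiamond N K) × LevelPerms (2 * N) K) :=
    (((decouple hK).symm (e.symm v₀)).1, ((decouple hK).symm (e.symm v₀)).2, ⟨1, rfl, rfl⟩)
  refine ⟨hnonneg, isProbabilityMeasure_normalizedMeasure hnonneg ?_ ⟨Φ q₀, ?_⟩, sortedPaths N K, e,
    upperPart hK, ae_normalizedMeasure fun u hu => ?_, he, fun S t => tile_decoupled hK S,
    fun S t => mem_upperPart hK S, ?_⟩
  · exact summable_of_hasFiniteSupport ((Set.finite_range Φ).subset hrange)
  · rw [hw]
    exact mul_pos (hA _) (hB _)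
  · obtain ⟨v, σ, rfl⟩ := exists_relabel_of_detWeight_ne_zero hu
    intro i
    rw [hpaths, range_relabel]
  · refine map_normalizedMeasure hΦ (κ := fun g => tilingWeight b c d (corridorTiling N K) *
      tilingWeight b c d g.1) hw h0 (fun A => (hA A).le) (fun g => (hB g.1).le)
      ⟨q₀.2, hB _⟩ (measurable_of_countable _) fun q => ?_
    rw [hsorted, Equiv.symm_apply_apply]
    exact congrArg Prod.fst ((decouple hK).symm_apply_apply (q.1, q.2.1))

end Final

end AztecPaths

theorem proposition5p1 (p n N : ℕ) (M : ℤ) (hN : 1 ≤ N) (hM : (p : ℤ) * M = -(N : ℤ))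
    (hn : N ≤ p * n) (b c d : ℤ → ℤ → ℝ)
    (hb : ∀ m x : ℤ, 0 ≤ m → m ≤ N → 0 < b m x)
    (hc : ∀ m x : ℤ, 0 ≤ m → m ≤ N → 0 < c m x)
    (hd : ∀ m x : ℤ, 0 ≤ m → m ≤ N → 0 < d m x)
    (hbp : ∀ m x : ℤ, 0 ≤ m → m ≤ N → b m (x + p) = b m x)
    (hcp : ∀ m x : ℤ, 0 ≤ m → m ≤ N → c m (x + p) = c m x)
    (hdp : ∀ m x : ℤ, 0 ≤ m → m ≤ N → d m (x + p) = d m x) :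
    -- the transition matrices are block Toeplitz matrices
    (∀ i : ℕ, 1 ≤ i → i ≤ 2 * N → ∀ x y : ℤ,
      transition N (p * n) b c d i (x + p) (y + p) = transition N (p * n) b c d i x y) ∧
    -- the normalized product of determinants is a probability measure
    (∀ u, 0 ≤ detWeight (2 * N) (p * n) (p * M) (transition N (p * n) b c d) u) ∧
    IsProbabilityMeasure (detMeasure (2 * N) (p * n) (p * M) (transition N (p * n) b c d)) ∧
    ∃ (paths : Config (2 * N) (p * n) → NonIntersectingPaths N (p * n) (p * M))
      (e : DominoTiling N (extendedDomain N (p * n : ℕ)) ≃ NonIntersectingPaths N (p * n) (p * M))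
      (r : DominoTiling N (extendedDomain N (p * n : ℕ)) → DominoTiling N (aztecDiamond N)),
      -- it is carried by the non-intersecting paths, up to the labels of the points of a level
      (∀ᵐ u ∂(detMeasure (2 * N) (p * n) (p * M) (transition N (p * n) b c d)),
        ∀ i, Set.range ((paths u).1 i) = Set.range (u i)) ∧
      -- drawing lines on dominoes is a bijection from the tilings of the extended domain
      (∀ S, IsDrawing S (e S).1) ∧
      -- each tiling of the extended domain decouples into three parts
      (∀ S : DominoTiling N (extendedDomain N (p * n : ℕ)),
        ∀ t ∈ S.tiles, Tile.cells N t ⊆ aztecDiamond N ∨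
        (Tile.cells N t ⊆ corridor N (p * n : ℕ) ∧ t.1 = TileKind.south) ∨
        Tile.cells N t ⊆ lowerDiamond N (p * n : ℕ)) ∧
      -- and contains a tiling of the Aztec diamond of size `N`
      (∀ (S : DominoTiling N (extendedDomain N (p * n : ℕ))) (t : Tile),
        t ∈ (r S).tiles ↔ t ∈ S.tiles ∧ Tile.cells N t ⊆ aztecDiamond N) ∧
      -- the induced measure on the tilings of the Aztec diamond is the weighted tiling measure
      Measure.map (fun u => r (e.symm (paths u)))
          (detMeasure (2 * N) (p * n) (p * M) (transition N (p * n) b c d)) =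
        normalizedMeasure
          (tilingWeight b c d : DominoTiling N (aztecDiamond N) → ℝ) := by
  refine ⟨fun i _ hi x y => transition_add_period hbp hcp hdp hi x y, ?_⟩
  rw [hM]
  exact paths_tilings_measure hN hn hb hc hd
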